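/- A vector field $Y:\mathbb R^2\to\mathbb R^2$ is called homogeneous of degree $\alpha\ge 0$ if $Y(rx,ry)=r^{\alpha}Y(x,y)$ for all $(x,y)\in\mathbb R^2$ and all real $r\ge 0$ (with $0^0=1$). A periodic orbit of a continuous vector field is the image of a nonconstant periodic solution of the associated differential equation. A limit cycle is a periodic orbit that is isolated in the set of all periodic orbits, i.e. it has a neighbourhood which no other periodic orbit meets. A periodic orbit of a $\mathcal C^1$ vector field is hyperbolic if exactly one of its characteristic (Floquet) multipliers, counted with multiplicity, has modulus $1$ (namely the trivial multiplier $1$). **Theorem.** Let $n\ge 0$ and, for $j=0,1,\dots,n$, let $X_j=(f_j,g_j):\mathbb R^2\to\mathbb R^2$ be a continuous vector field (not necessarily locally Lipschitz), homogeneous of degree $\alpha_j$, with $0\le\alpha_0<\alpha_1<\dots<\alpha_n$. Consider the vector fields $$X_{\mathbf a}(x,y)=(-y,x)+\sum_{j=0}^n a_jX_j(x,y),\qquad \mathbf a=(a_0,\dots,a_n)\in\mathbb R^{n+1},$$ and put $$I_j=\int_0^{2\pi}\big(f_j(\cos\theta,\sin\theta)\cos\theta+g_j(\cos\theta,\sin\theta)\sin\theta\big)\,d\theta,\qquad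 j=0,1,\dots,n.$$ Suppose that exactly $m+1$ of the numbers $I_0,\dots,I_n$ are nonzero, where $m\ge 0$. Then there is $\mathbf a\in\mathbb R^{n+1}$ such that the differential equation $(\dot x,\dot y)=X_{\mathbf a}(x,y)$ has at least $m$ limit cycles. More precisely, there are such an $\mathbf a$ and $m$ distinct limit cycles of $X_{\mathbf a}$ which, if all the $X_j$ are of class $\mathcal C^1$ on $\mathbb R^2$, are moreover all hyperbolic. -/

import Mathlib

open Real Set

noncomputable section

/-- `X` is homogeneous with degree of homogeneity `α ≥ 0`, with the convention `0 ^ 0 = 1`. -/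
def IsHomogeneousField (X : ℝ × ℝ → ℝ × ℝ) (α : ℝ) : Prop :=
  0 ≤ α ∧ ∀ (p : ℝ × ℝ) (r : ℝ), 0 ≤ r → X (r • p) = (r ^ α) • X p

/-- The integral `∫₀^{2π} (f(cos θ, sin θ) cos θ + g(cos θ, sin θ) sin θ) dθ` for `X = (f, g)`. -/
def radialIntegral (X : ℝ × ℝ → ℝ × ℝ) : ℝ :=
  ∫ θ in (0 : ℝ)..(2 * π),
    ((X (cos θ, sin θ)).1 * cos θ + (X (cos θ, sin θ)).2 * sin θ)

/-- The vector field `(-y, x) + ∑ j, a j • X j (x, y)`. -/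
def perturbedCenter {n : ℕ} (X : Fin (n + 1) → ℝ × ℝ → ℝ × ℝ) (a : Fin (n + 1) → ℝ) :
    ℝ × ℝ → ℝ × ℝ :=
  fun p => (-p.2, p.1) + ∑ j, a j • X j p

/-- `γ` is a periodic solution of `γ' = v(γ)` with minimal period `T > 0`. A constant solution is
excluded, since it has no minimal positive period; a nonconstant continuous periodic function
always has one. -/
structure IsPeriodicSolution (v : ℝ × ℝ → ℝ × ℝ) (γ : ℝ → ℝ × ℝ) (T : ℝ) : Prop where
  hasDerivAt : ∀ t : ℝ, HasDerivAt γ (v (γ t)) t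
  pos : 0 < T
  periodic : Function.Periodic γ T
  minimal : ∀ s : ℝ, 0 < s → Function.Periodic γ s → T ≤ s

/-- A periodic orbit is the trace of a nonconstant periodic solution. -/
def IsPeriodicOrbit (v : ℝ × ℝ → ℝ × ℝ) (Γ : Set (ℝ × ℝ)) : Prop :=
  ∃ (γ : ℝ → ℝ × ℝ) (T : ℝ), IsPeriodicSolution v γ T ∧ range γ = Γ

/-- A limit cycle is a periodic orbit which is isolated in the set of all periodic orbits: it has a
neighbourhood that no other periodic orbit meets (in particular, none is contained in it). -/
def IsLimitCycle (v : ℝ × ℝ → ℝ × ℝ) (Γ : Set (ℝ × ℝ)) : Prop :=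
  IsPeriodicOrbit v Γ ∧
    ∃ U : Set (ℝ × ℝ), IsOpen U ∧ Γ ⊆ U ∧
      ∀ Γ' : Set (ℝ × ℝ), IsPeriodicOrbit v Γ' → (Γ' ∩ U).Nonempty → Γ' = Γ

/-- `M` is the monodromy operator of the `T`-periodic solution `γ`: the value at time `T` of the
principal fundamental solution of the variational equation `Φ' = Dv(γ(t)) Φ`, `Φ(0) = Id`. -/
def IsMonodromy (v : ℝ × ℝ → ℝ × ℝ) (γ : ℝ → ℝ × ℝ) (T : ℝ) (M : ℝ × ℝ →L[ℝ] ℝ × ℝ) : Prop :=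
  ∃ Φ : ℝ → ℝ × ℝ →L[ℝ] ℝ × ℝ,
    Φ 0 = ContinuousLinearMap.id ℝ (ℝ × ℝ) ∧
    (∀ t : ℝ, HasDerivAt Φ ((fderiv ℝ v (γ t)).comp (Φ t)) t) ∧
    Φ T = M

open Classical in
/-- Hyperbolicity of a periodic orbit of a `C¹` vector field: exactly one of the characteristic
(Floquet) multipliers, i.e. of the complex eigenvalues of the monodromy operator counted with
algebraic multiplicity, lies on the unit circle (namely the trivial multiplier `1`). -/
def IsHyperbolicOrbit (v : ℝ × ℝ → ℝ × ℝ) (Γ : Set (ℝ × ℝ)) : Prop :=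
  ∃ (γ : ℝ → ℝ × ℝ) (T : ℝ) (M : ℝ × ℝ →L[ℝ] ℝ × ℝ),
    IsPeriodicSolution v γ T ∧ range γ = Γ ∧ IsMonodromy v γ T M ∧
    ((LinearMap.charpoly (M : ℝ × ℝ →ₗ[ℝ] ℝ × ℝ)).aroots ℂ).countP (fun z => ‖z‖ = 1) = 1

end

open scoped Topology

noncomputable section

/-! Take `a = ε b` with `ε > 0` small. In polar coordinates, homogeneity gives `ṙ = ε S(r, θ)`, `θ̇
= 1 + ε G(r, θ)`, where `S` and `G` are sums of powers of `r` times continuous periodic functions of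
`θ`. They are therefore smooth in `r > 0` even when the planar field is not Lipschitz. To first
order the change of `r` over one turn is `ε ∑ b_j I_j r ^ α_j`, and each simple positive zero of
this generalized polynomial yields a limit cycle.

Enough simple zeros exist (`exists_generalizedPolynomial_simple_zeros`): with `r = e^x` the
polynomial becomes an exponential sum with `m + 1` free coefficients. Linear algebra makes a
nontrivial sum vanish at `m` given points, and a Rolle induction shows that an additional
multiplicity would force it to be trivial.

Averaging (`IsAveragingData.eventually_exists_limitCycle`) solves `dr/dθ = ε S / (1 + ε G)` and
finds a periodic solution `φ` by the intermediate value theorem. Isolation must hold among all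
planar periodic solutions, without using uniqueness for the planar equation. It comes from a
Lyapunov-type function `((r - φ) e^{-g})²`, strictly monotone along every orbit near the curve but
off it (`IsAnnularField.isLimitCycle`). The periodic weight `g` replaces the `r`-derivative of `S`
at the zero by its mean.

In the `C¹` case the nontrivial multiplier is `exp ∫ div`. This integral is nonzero because its
leading part is `ε` times the derivative of the averaged polynomial at its zero
(`integral_divergence_circle`, `exists_integral_ne_zero_of_near_circle`). -/

/-! ### Exponential sums and generalized polynomials with simple zeros. -/

theorem exponentialSum_rolle {k : ℕ} (β c : Fin (k + 1) → ℝ) {a b : ℝ} (hab : a < b)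
    (ha : ∑ j, c j * exp (β j * a) = 0) (hb : ∑ j, c j * exp (β j * b) = 0) :
    ∃ ξ ∈ Ioo a b,
      ∑ j : Fin k, (c j.succ * (β j.succ - β 0)) * exp ((β j.succ - β 0) * ξ) = 0 := by
  -- The factor `exp (-(β 0 * x))` keeps the zeros and makes the term of index `0` constant, so
  -- differentiation removes it.
  have key : ∀ x, ∑ j, c j * exp ((β j - β 0) * x) = exp (-(β 0 * x)) * ∑ j, c j * exp (β j * x) := by
    intro x
    rw [Finset.mul_sum]
    refine Finset.sum_congr rfl fun j _ => ?_
    rw [mul_left_comm, ← exp_add]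
    ring_nf
  have hder : ∀ x, HasDerivAt (fun x => ∑ j, c j * exp ((β j - β 0) * x))
      (∑ j : Fin k, (c j.succ * (β j.succ - β 0)) * exp ((β j.succ - β 0) * x)) x := by
    intro x
    have : HasDerivAt (fun x => ∑ j, c j * exp ((β j - β 0) * x))
        (∑ j, c j * (exp ((β j - β 0) * x) * ((β j - β 0) * 1))) x :=
      HasDerivAt.fun_sum fun j _ => (((hasDerivAt_id x).const_mul _).exp).const_mul _
    convert this using 1
    rw [Fin.sum_univ_succ]
    simp only [sub_self, zero_mul, mul_zero, zero_add, mul_one]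
    exact Finset.sum_congr rfl fun j _ => by ring
  obtain ⟨ξ, hξ, h⟩ := exists_hasDerivAt_eq_zero hab
    (fun x _ => (hder x).continuousAt.continuousWithinAt)
    (by simp only [key, ha, hb, mul_zero]) (fun x _ => hder x)
  exact ⟨ξ, hξ, h⟩

/-- The derivative of `e^{-β₀ x} f` is `e^{-β₀ x} (f' - β₀ f)`; thus a double zero of `f` persists
as a zero of the reduced sum, without Rolle. -/
theorem exponentialSum_derivative_eq_zero {k : ℕ} (β c : Fin (k + 1) → ℝ) {x : ℝ}
    (h0 : ∑ j, c j * exp (β j * x) = 0) (h1 : ∑ j, c j * β j * exp (β j * x) = 0) :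
    ∑ j : Fin k, (c j.succ * (β j.succ - β 0)) * exp ((β j.succ - β 0) * x) = 0 := by
  have : ∑ j, (c j * (β j - β 0)) * exp ((β j - β 0) * x) =
      exp (-(β 0 * x)) * (∑ j, c j * β j * exp (β j * x) - β 0 * ∑ j, c j * exp (β j * x)) := by
    rw [Finset.mul_sum, ← Finset.sum_sub_distrib, Finset.mul_sum]
    refine Finset.sum_congr rfl fun j _ => ?_
    have : exp ((β j - β 0) * x) = exp (-(β 0 * x)) * exp (β j * x) := by
      rw [← exp_add]; ring_nf
    rw [this]; ring
  rw [h0, h1, Fin.sum_univ_succ] at this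
  simpa using this

/-- Undoes the reduction: the factors `β j.succ - β 0` are nonzero, and the one remaining term has
no zeros unless its coefficient vanishes. -/
theorem eq_zero_of_succ_eq_zero {k : ℕ} (β c : Fin (k + 1) → ℝ) (hβ : Function.Injective β) {x : ℝ}
    (h0 : ∑ j, c j * exp (β j * x) = 0)
    (h : (fun j : Fin k => c j.succ * (β j.succ - β 0)) = 0) : c = 0 := by
  have hs : ∀ j : Fin k, c j.succ = 0 := fun j => by
    have := congrFun h j
    simp only [Pi.zero_apply, mul_eq_zero, sub_eq_zero] at this
    exact this.resolve_right fun h => Fin.succ_ne_zero j (hβ h)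
  rw [Fin.sum_univ_succ] at h0
  simp only [hs, zero_mul, Finset.sum_const_zero, add_zero, mul_eq_zero, exp_ne_zero, or_false] at h0
  funext j
  exact Fin.cases h0 hs j

/-- A sum of `k` exponentials with distinct rates and `k` distinct zeros is trivial. -/
theorem exponentialSum_coeff_eq_zero : ∀ {k : ℕ} (β c x : Fin k → ℝ), Function.Injective β →
    StrictMono x → (∀ i, ∑ j, c j * exp (β j * x i) = 0) → c = 0
  | 0, _, _, _, _, _, _ => Subsingleton.elim _ _
  | k + 1, β, c, x, hβ, hx, h => by
    choose ξ hξ hξ0 using fun i : Fin k =>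
      exponentialSum_rolle β c (hx (Fin.castSucc_lt_succ (i := i))) (h _) (h _)
    refine eq_zero_of_succ_eq_zero β c hβ (h 0) ?_
    refine exponentialSum_coeff_eq_zero (fun j => β j.succ - β 0) _ ξ ?_ ?_ hξ0
    · intro i j hij
      exact Fin.succ_injective _ (hβ (sub_left_injective hij))
    · intro i j hij
      exact (hξ i).2.trans_le ((hx.monotone (Fin.succ_le_castSucc_iff.2 hij)).trans (hξ j).1.le)

/-- A sum of `m + 1` exponentials with distinct rates and `m` distinct zeros, one of which is
multiple, is trivial. -/
theorem exponentialSum_coeff_eq_zero_of_double {m : ℕ} (β c : Fin (m + 1) → ℝ) (x : Fin m → ℝ)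
    (hβ : Function.Injective β) (hx : StrictMono x) (h : ∀ i, ∑ j, c j * exp (β j * x i) = 0)
    (i₀ : Fin m) (h₀ : ∑ j, c j * β j * exp (β j * x i₀) = 0) : c = 0 := by
  -- Rolle gives only `m - 1` zeros of the reduced sum, and the double zero itself supplies the
  -- missing one. The index `i` stands for the gap to the right of `x i` if `i < i₀`, and for the
  -- gap to its left if `i > i₀`.
  have hex : ∀ i : Fin m, ∃ η : ℝ,
      (i < i₀ → x i < η ∧ ∀ i', i < i' → η < x i') ∧ (i = i₀ → η = x i₀) ∧
      (i₀ < i → η < x i ∧ ∀ i', i' < i → x i' < η) ∧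
      ∑ j : Fin m, (c j.succ * (β j.succ - β 0)) * exp ((β j.succ - β 0) * η) = 0 := by
    intro i
    rcases lt_trichotomy i i₀ with hi | hi | hi
    · have hlt : (i : ℕ) + 1 < m := by have := i₀.2; have : (i : ℕ) < i₀ := hi; omega
      obtain ⟨η, hη, h1⟩ := exponentialSum_rolle β c
        (hx (show i < ⟨i + 1, hlt⟩ from Nat.lt_succ_self _)) (h _) (h _)
      exact ⟨η, fun _ => ⟨hη.1, fun i' hi' => hη.2.trans_le (hx.monotone
        (show (i : ℕ) + 1 ≤ i' from hi'))⟩, fun h => absurd h hi.ne, fun h => absurd h hi.asymm, h1⟩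
    · exact ⟨x i₀, fun h => absurd h (hi ▸ lt_irrefl _), fun _ => rfl,
        fun h => absurd h (hi ▸ lt_irrefl _), exponentialSum_derivative_eq_zero β c (h _) h₀⟩
    · have hpos : 0 < (i : ℕ) := lt_of_le_of_lt (Nat.zero_le _) (show (i₀ : ℕ) < i from hi)
      obtain ⟨η, hη, h1⟩ := exponentialSum_rolle β c
        (hx (show (⟨i - 1, by omega⟩ : Fin m) < i from Nat.sub_lt hpos one_pos)) (h _) (h _)
      refine ⟨η, fun h => absurd h hi.asymm, fun h => absurd h hi.ne', fun _ => ⟨hη.2,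
        fun i' hi' => lt_of_le_of_lt (hx.monotone ?_) hη.1⟩, h1⟩
      have : (i' : ℕ) < i := hi'
      show (i' : ℕ) ≤ i - 1
      omega
  choose η hη1 hη2 hη3 hη4 using hex
  refine eq_zero_of_succ_eq_zero β c hβ (h i₀) ?_
  refine exponentialSum_coeff_eq_zero (fun j => β j.succ - β 0) _ η ?_ ?_ hη4
  · intro i j hij
    exact Fin.succ_injective _ (hβ (sub_left_injective hij))
  · intro i j hij
    rcases lt_trichotomy i i₀ with hi | hi | hi
    · have h1 := (hη1 i hi).2 j hij
      rcases lt_trichotomy j i₀ with hj | hj | hj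
      · exact h1.trans (hη1 j hj).1
      · rw [hη2 j hj, ← hj]; exact h1
      · exact ((hη1 i hi).2 i₀ hi).trans ((hη3 j hj).2 i₀ hj)
    · rw [hη2 i hi]
      exact (hη3 j (hi ▸ hij)).2 i₀ (hi ▸ hij)
    · exact (hη3 i hi).1.trans ((hη3 j (hi.trans hij)).2 i hij)

/-- Exponential sums with `m + 1` distinct rates can be given `m` prescribed simple zeros. -/
theorem exists_exponentialSum_simple_zeros {m : ℕ} (β : Fin (m + 1) → ℝ) (x : Fin m → ℝ)
    (hβ : Function.Injective β) (hx : StrictMono x) :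
    ∃ c : Fin (m + 1) → ℝ, ∀ i, ∑ j, c j * exp (β j * x i) = 0 ∧
      ∑ j, c j * β j * exp (β j * x i) ≠ 0 := by
  let L : (Fin (m + 1) → ℝ) →ₗ[ℝ] (Fin m → ℝ) :=
    Matrix.mulVecLin (Matrix.of fun i j => exp (β j * x i))
  -- There are `m` vanishing conditions on `m + 1` coefficients.
  have hker : LinearMap.ker L ≠ ⊥ := L.ker_ne_bot_of_finrank_lt (by simp)
  obtain ⟨c, hc, hc0⟩ := (Submodule.ne_bot_iff _).1 hker
  have hz : ∀ i, ∑ j, c j * exp (β j * x i) = 0 := fun i => by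
    have := congrFun (LinearMap.mem_ker.1 hc) i
    simp only [L, Matrix.mulVecLin_apply, Matrix.mulVec, dotProduct, Matrix.of_apply,
      Pi.zero_apply] at this
    rw [← this]
    exact Finset.sum_congr rfl fun j _ => mul_comm _ _
  exact ⟨c, fun i => ⟨hz i, fun h => hc0 (exponentialSum_coeff_eq_zero_of_double β c x hβ hx hz i h)⟩⟩

/-- Coefficients for which the generalized polynomial `∑ j, b j * I j * r ^ α j` has `m` simple
positive zeros, when `m + 1` of the `I j` are nonzero. -/
theorem exists_generalizedPolynomial_simple_zeros {N m : ℕ} (I α : Fin N → ℝ) (hα : StrictMono α)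
    (hI : {j | I j ≠ 0}.ncard = m + 1) :
    ∃ (b : Fin N → ℝ) (ρ : Fin m → ℝ), StrictMono ρ ∧ ∀ i, 0 < ρ i ∧
      ∑ j, b j * I j * ρ i ^ α j = 0 ∧ ∑ j, b j * I j * α j * ρ i ^ α j ≠ 0 := by
  classical
  have hcard : (Finset.univ.filter fun j => I j ≠ 0).card = m + 1 := by
    rw [← hI, ← Set.ncard_coe_finset]; congr 1; ext; simp
  set s := Finset.univ.filter fun j => I j ≠ 0 with hs
  let e := s.orderEmbOfFin hcard
  have hmem : ∀ k, I (e k) ≠ 0 := fun k =>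
    (Finset.mem_filter.1 (s.orderEmbOfFin_mem hcard k)).2
  obtain ⟨c, hc⟩ := exists_exponentialSum_simple_zeros (fun k => α (e k)) (fun i : Fin m => (i : ℝ))
    (hα.injective.comp e.injective) (fun i j h => Nat.cast_lt.2 h)
  -- Dividing by `I j` on the support of `I`, and taking zero off it, turns weighted sums over all
  -- indices into exponential sums over the `m + 1` good ones.
  have hsum : ∀ F : Fin N → ℝ, ∑ j, (if h : ∃ k, e k = j then c h.choose / I j else 0) * I j * F j =
      ∑ k, c k * F (e k) := by
    intro F
    rw [← Finset.sum_subset (Finset.subset_univ (Finset.univ.map e.toEmbedding))]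
    · rw [Finset.sum_map]
      refine Finset.sum_congr rfl fun k _ => ?_
      have hk : ∃ k', e k' = e.toEmbedding k := ⟨k, rfl⟩
      rw [dif_pos hk]
      have : hk.choose = k := e.injective hk.choose_spec
      rw [this]
      have := hmem k
      simp only [RelEmbedding.coe_toEmbedding]
      field_simp
    · intro j _ hj
      have : ¬ ∃ k, e k = j := by
        rintro ⟨k, rfl⟩
        exact hj (Finset.mem_map.2 ⟨k, Finset.mem_univ _, rfl⟩)
      rw [dif_neg this]; ring
  have hpow : ∀ (i : Fin m) (a : ℝ), exp (i : ℝ) ^ a = exp (a * i) := fun i a => by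
    rw [← exp_mul, mul_comm]
  refine ⟨fun j => if h : ∃ k, e k = j then c h.choose / I j else 0, fun i => exp (i : ℕ),
    fun i j h => exp_lt_exp.2 (Nat.cast_lt.2 h), fun i => ⟨exp_pos _, ?_, ?_⟩⟩
  · rw [hsum fun j => exp (i : ℝ) ^ α j, ← (hc i).1]
    simp only [hpow]
  · have := hsum fun j => α j * exp (i : ℝ) ^ α j
    simp only [← mul_assoc] at this
    rw [this]
    simp only [hpow]
    exact (hc i).2

/-! ### Polar coordinates and local branches of the angle. -/

/-- The point with polar coordinates `(r, θ)`. -/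
def polarPoint (r θ : ℝ) : ℝ × ℝ := (r * cos θ, r * sin θ)

/-- The Euclidean norm on `ℝ × ℝ`. -/
def radius (p : ℝ × ℝ) : ℝ := √(p.1 ^ 2 + p.2 ^ 2)

/-- The branch of the argument whose cut is opposite to the direction `θ₀`. -/
def angleNear (θ₀ : ℝ) (p : ℝ × ℝ) : ℝ :=
  θ₀ + Complex.arg ((p.1 + p.2 * Complex.I) * Complex.exp (-(θ₀ * Complex.I)))

theorem HasDerivAt.fst_coord {γ : ℝ → ℝ × ℝ} {w : ℝ × ℝ} {t : ℝ} (h : HasDerivAt γ w t) :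
    HasDerivAt (fun s => (γ s).1) w.1 t :=
  (ContinuousLinearMap.fst ℝ ℝ ℝ).hasFDerivAt.comp_hasDerivAt t h

theorem HasDerivAt.snd_coord {γ : ℝ → ℝ × ℝ} {w : ℝ × ℝ} {t : ℝ} (h : HasDerivAt γ w t) :
    HasDerivAt (fun s => (γ s).2) w.2 t :=
  (ContinuousLinearMap.snd ℝ ℝ ℝ).hasFDerivAt.comp_hasDerivAt t h

theorem Continuous.hasDerivAt_primitive {κ : ℝ → ℝ} (hκ : Continuous κ) (a t : ℝ) :
    HasDerivAt (fun t => ∫ s in a..t, κ s) (κ t) t :=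
  intervalIntegral.integral_hasDerivAt_right (hκ.intervalIntegrable _ _)
    (hκ.stronglyMeasurableAtFilter _ _) hκ.continuousAt

theorem radius_polarPoint {r : ℝ} (hr : 0 ≤ r) (θ : ℝ) : radius (polarPoint r θ) = r := by
  rw [radius, polarPoint]
  have : (r * cos θ) ^ 2 + (r * sin θ) ^ 2 = r ^ 2 := by
    rw [mul_pow, mul_pow, ← mul_add, cos_sq_add_sin_sq, mul_one]
  simp only [this, sqrt_sq hr]

theorem continuous_radius : Continuous radius := by unfold radius; fun_prop

theorem polarPoint_coe (r θ : ℝ) : ((polarPoint r θ).1 + (polarPoint r θ).2 * Complex.I : ℂ) =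
    r * Complex.exp (θ * Complex.I) := by
  rw [Complex.exp_mul_I]
  simp only [polarPoint]
  push_cast
  ring

theorem polarPoint_angleNear (θ₀ : ℝ) (p : ℝ × ℝ) :
    polarPoint (radius p) (angleNear θ₀ p) = p := by
  have hn : ‖(p.1 + p.2 * Complex.I : ℂ) * Complex.exp (-(θ₀ * Complex.I))‖ = radius p := by
    rw [norm_mul, ← neg_mul, ← Complex.ofReal_neg, Complex.norm_exp_ofReal_mul_I, mul_one,
      Complex.norm_add_mul_I, radius]
  have h := Complex.norm_mul_exp_arg_mul_I
    ((p.1 + p.2 * Complex.I : ℂ) * Complex.exp (-(θ₀ * Complex.I)))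
  have h2 : ((polarPoint (radius p) (angleNear θ₀ p)).1 +
      (polarPoint (radius p) (angleNear θ₀ p)).2 * Complex.I : ℂ) = p.1 + p.2 * Complex.I := by
    rw [polarPoint_coe, angleNear, Complex.ofReal_add, add_mul, Complex.exp_add, mul_left_comm,
      ← hn, h, mul_left_comm, ← Complex.exp_add, add_neg_cancel, Complex.exp_zero, mul_one]
  have hre := congrArg Complex.re h2
  have him := congrArg Complex.im h2
  simp at hre him
  exact Prod.ext hre him

theorem rotate_polarPoint (r θ₀ : ℝ) : (((polarPoint r θ₀).1 + (polarPoint r θ₀).2 * Complex.I) *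
    Complex.exp (-(θ₀ * Complex.I)) : ℂ) = r := by
  rw [polarPoint_coe, mul_assoc, ← Complex.exp_add, add_neg_cancel, Complex.exp_zero, mul_one]

theorem angleNear_polarPoint {r : ℝ} (hr : 0 ≤ r) (θ₀ : ℝ) :
    angleNear θ₀ (polarPoint r θ₀) = θ₀ := by
  rw [angleNear, rotate_polarPoint, Complex.arg_ofReal_of_nonneg hr, add_zero]

theorem continuousAt_angleNear {r : ℝ} (hr : 0 < r) (θ₀ : ℝ) :
    ContinuousAt (angleNear θ₀) (polarPoint r θ₀) := by
  unfold angleNear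
  refine continuousAt_const.add ?_
  refine ContinuousAt.comp (g := Complex.arg) (Complex.continuousAt_arg ?_) (by fun_prop)
  rw [rotate_polarPoint]
  exact Complex.ofReal_mem_slitPlane.2 hr

/-- After rotation by `-θ₀` the point is a positive real, away from the cut, so the angle is the
imaginary part of a differentiable logarithm. -/
theorem hasDerivAt_angleNear {γ : ℝ → ℝ × ℝ} {w : ℝ × ℝ} {t r θ₀ : ℝ} (hγ : HasDerivAt γ w t)
    (hr : 0 < r) (h0 : γ t = polarPoint r θ₀) :
    HasDerivAt (fun s => angleNear θ₀ (γ s)) ((w.2 * cos θ₀ - w.1 * sin θ₀) / r) t := by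
  have h1 : HasDerivAt (fun s => (((γ s).1 + (γ s).2 * Complex.I) *
      Complex.exp (-(θ₀ * Complex.I)) : ℂ))
      ((w.1 + w.2 * Complex.I) * Complex.exp (-(θ₀ * Complex.I))) t := by
    have ha : HasDerivAt (fun s => (γ s).1) w.1 t := hγ.fst_coord
    have hb : HasDerivAt (fun s => (γ s).2) w.2 t := hγ.snd_coord
    exact (ha.ofReal_comp.add (hb.ofReal_comp.mul_const _)).mul_const _
  have hz : (((γ t).1 + (γ t).2 * Complex.I) * Complex.exp (-(θ₀ * Complex.I)) : ℂ) = r := by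
    rw [h0, rotate_polarPoint]
  have h2 := h1.clog_real (by rw [hz]; exact Complex.ofReal_mem_slitPlane.2 hr)
  have h3 := Complex.imCLM.hasFDerivAt.comp_hasDerivAt t h2
  simp only [Function.comp_def, Complex.imCLM_apply, Complex.log_im] at h3
  have h4 := h3.const_add θ₀
  rw [hz] at h4
  refine h4.congr_deriv ?_
  rw [Complex.div_ofReal_im, ← neg_mul, ← Complex.ofReal_neg,
    Complex.exp_mul_I, ← Complex.ofReal_cos, ← Complex.ofReal_sin]
  simp [-Complex.ofReal_cos, -Complex.ofReal_sin]
  ring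

theorem hasDerivAt_radius {γ : ℝ → ℝ × ℝ} {w : ℝ × ℝ} {t r θ₀ : ℝ} (hγ : HasDerivAt γ w t)
    (hr : 0 < r) (h0 : γ t = polarPoint r θ₀) :
    HasDerivAt (fun s => radius (γ s)) (w.1 * cos θ₀ + w.2 * sin θ₀) t := by
  have ha : HasDerivAt (fun s => (γ s).1) w.1 t := hγ.fst_coord
  have hb : HasDerivAt (fun s => (γ s).2) w.2 t := hγ.snd_coord
  have hrad : √((γ t).1 ^ 2 + (γ t).2 ^ 2) = r := by
    have := radius_polarPoint hr.le θ₀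
    rwa [← h0] at this
  have hne : (γ t).1 ^ 2 + (γ t).2 ^ 2 ≠ 0 := fun h => by
    rw [h, sqrt_zero] at hrad; exact hr.ne hrad
  have h := ((ha.pow 2).add (hb.pow 2)).sqrt hne
  refine h.congr_deriv ?_
  simp only [Pi.add_apply, Pi.pow_apply]
  rw [hrad, h0]
  simp only [polarPoint]
  field_simp
  norm_num
  ring

theorem eq_add_int_mul_of_polarPoint_eq {r r' θ θ' : ℝ} (hr : 0 < r) (hr' : 0 < r')
    (h : polarPoint r θ = polarPoint r' θ') : ∃ k : ℤ, θ = θ' + k * (2 * π) := by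
  have hrr : r = r' := by
    rw [← radius_polarPoint hr.le θ, h, radius_polarPoint hr'.le]
  subst hrr
  simp only [polarPoint, Prod.mk.injEq, mul_right_inj' hr.ne'] at h
  obtain ⟨k, hk⟩ := Real.Angle.angle_eq_iff_two_pi_dvd_sub.1 (Real.Angle.cos_sin_inj h.1 h.2)
  exact ⟨k, by linarith⟩

theorem polarPoint_add_int_mul (r θ : ℝ) (k : ℤ) :
    polarPoint r (θ + k * (2 * π)) = polarPoint r θ := by
  simp only [polarPoint, cos_add_int_mul_two_pi, sin_add_int_mul_two_pi]

/-- Makes `2π`-periodic functions of the angle well defined on the punctured plane, so that the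
branch can be changed freely. -/
theorem Function.Periodic.eq_of_polarPoint_eq {β : Type*} {ψ : ℝ → β}
    (hψ : Function.Periodic ψ (2 * π)) {r r' θ θ' : ℝ} (hr : 0 < r) (hr' : 0 < r')
    (h : polarPoint r θ = polarPoint r' θ') : ψ θ = ψ θ' := by
  obtain ⟨k, rfl⟩ := eq_add_int_mul_of_polarPoint_eq hr hr' h
  exact hψ.int_mul k θ'

theorem Function.Periodic.angleNear_eq {β : Type*} {ψ : ℝ → β}
    (hψ : Function.Periodic ψ (2 * π)) {p : ℝ × ℝ} (hp : 0 < radius p) (θ₀ θ₁ : ℝ) :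
    ψ (angleNear θ₀ p) = ψ (angleNear θ₁ p) :=
  hψ.eq_of_polarPoint_eq hp hp (by simp only [polarPoint_angleNear])

theorem continuous_polarPoint {r θ : ℝ → ℝ} (hr : Continuous r) (hθ : Continuous θ) :
    Continuous fun t => polarPoint (r t) (θ t) := by
  unfold polarPoint; fun_prop

theorem hasDerivAt_polarPoint {r θ : ℝ → ℝ} {r' θ' t : ℝ} (hr : HasDerivAt r r' t)
    (hθ : HasDerivAt θ θ' t) : HasDerivAt (fun t => polarPoint (r t) (θ t))
      (r' * cos (θ t) - r t * θ' * sin (θ t), r' * sin (θ t) + r t * θ' * cos (θ t)) t := by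
  refine HasDerivAt.prodMk ?_ ?_
  · exact (hr.mul hθ.cos).congr_deriv (by ring)
  · exact (hr.mul hθ.sin).congr_deriv (by ring)

/-- A nowhere vanishing curve with angular velocity `ω` is `r e^{iΘ}` for every primitive `Θ` of `ω`
with the right initial value. -/
theorem eq_polarPoint_of_angular_velocity {γ : ℝ → ℝ × ℝ} {κ ω Θ : ℝ → ℝ} (hκ : Continuous κ)
    (hγ : ∀ t, HasDerivAt γ (κ t * (γ t).1 - ω t * (γ t).2, κ t * (γ t).2 + ω t * (γ t).1) t)
    (hΘ : ∀ t, HasDerivAt Θ (ω t) t) (h0 : γ 0 = polarPoint (radius (γ 0)) (Θ 0)) (t : ℝ) :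
    γ t = polarPoint (radius (γ t)) (Θ t) := by
  let K : ℝ → ℝ := fun t => ∫ s in (0 : ℝ)..t, κ s
  have hK : ∀ t, HasDerivAt K (κ t) t := hκ.hasDerivAt_primitive 0
  have ha : ∀ t, HasDerivAt (fun s => (γ s).1) _ t := fun t => (hγ t).fst_coord
  have hb : ∀ t, HasDerivAt (fun s => (γ s).2) _ t := fun t => (hγ t).snd_coord
  -- In complex notation `γ' = (κ + iω) γ`, so `γ e^{-iΘ - K}` is constant. `hA` and `hB` are its
  -- real and imaginary parts; the initial condition makes the latter zero and the former
  -- nonnegative.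
  have hA : ∀ t, HasDerivAt (fun s => ((γ s).1 * cos (Θ s) + (γ s).2 * sin (Θ s)) * exp (-K s))
      0 t := fun t => by
    refine ((((ha t).mul (hΘ t).cos).add ((hb t).mul (hΘ t).sin)).mul (hK t).neg.exp).congr_deriv ?_
    simp
    ring
  have hB : ∀ t, HasDerivAt (fun s => ((γ s).2 * cos (Θ s) - (γ s).1 * sin (Θ s)) * exp (-K s))
      0 t := fun t => by
    refine ((((hb t).mul (hΘ t).cos).sub ((ha t).mul (hΘ t).sin)).mul (hK t).neg.exp).congr_deriv ?_
    simp
    ring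
  have hA' := is_const_of_deriv_eq_zero (fun s => (hA s).differentiableAt) (fun s => (hA s).deriv) t 0
  have hB' := is_const_of_deriv_eq_zero (fun s => (hB s).differentiableAt) (fun s => (hB s).deriv) t 0
  have hK0 : K 0 = 0 := intervalIntegral.integral_same
  have e1 : (γ 0).1 = radius (γ 0) * cos (Θ 0) := congrArg Prod.fst h0
  have e2 : (γ 0).2 = radius (γ 0) * sin (Θ 0) := congrArg Prod.snd h0
  have hcs := cos_sq_add_sin_sq (Θ 0)
  simp only [hK0, neg_zero, exp_zero, mul_one] at hA' hB'
  have hB0 : (γ 0).2 * cos (Θ 0) - (γ 0).1 * sin (Θ 0) = 0 := by rw [e1, e2]; ring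
  have hA0 : (γ 0).1 * cos (Θ 0) + (γ 0).2 * sin (Θ 0) = radius (γ 0) := by
    rw [e1, e2]; linear_combination radius (γ 0) * hcs
  rw [hB0, mul_eq_zero, or_iff_left (exp_ne_zero _)] at hB'
  have hAnn : 0 ≤ (γ t).1 * cos (Θ t) + (γ t).2 * sin (Θ t) := by
    refine nonneg_of_mul_nonneg_left (b := exp (-K t)) ?_ (exp_pos _)
    rw [hA', hA0]; exact sqrt_nonneg _
  have hpt : γ t = polarPoint ((γ t).1 * cos (Θ t) + (γ t).2 * sin (Θ t)) (Θ t) := by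
    have hcs := cos_sq_add_sin_sq (Θ t)
    refine Prod.ext ?_ ?_ <;> simp only [polarPoint]
    · linear_combination (-(γ t).1) * hcs - sin (Θ t) * hB'
    · linear_combination (-(γ t).2) * hcs + cos (Θ t) * hB'
  have hrad := radius_polarPoint hAnn (Θ t)
  rw [← hpt] at hrad
  rwa [hrad]

/-! ### Periodic solutions of scalar equations. -/

/-- A solution on one period of a periodic equation that returns to its initial value extends to a
periodic solution on the line. -/
theorem exists_periodic_extension {f : ℝ → ℝ → ℝ} {p : ℝ} (hp : 0 < p)
    (hper : ∀ r, Function.Periodic (fun θ => f θ r) p) {r : ℝ → ℝ}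
    (hr : ∀ θ ∈ Icc 0 p, HasDerivWithinAt r (f θ (r θ)) (Icc 0 p) θ) (h0 : r p = r 0) :
    ∃ φ : ℝ → ℝ, Function.Periodic φ p ∧ (∀ θ, HasDerivAt φ (f θ (φ θ)) θ) ∧
      ∀ θ, ∃ θ' ∈ Icc 0 p, φ θ = r θ' := by
  let φ : ℝ → ℝ := fun θ => r (toIcoMod hp 0 θ)
  have hφper : Function.Periodic φ p := fun θ => by simp only [φ, toIcoMod_add_right]
  have hmem : ∀ θ, toIcoMod hp 0 θ ∈ Ico 0 p := fun θ => by
    simpa only [zero_add] using toIcoMod_mem_Ico hp 0 θ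
  have hφr : ∀ θ ∈ Icc 0 p, φ θ = r θ := by
    intro θ hθ
    rcases hθ.2.lt_or_eq with h | rfl
    · simp only [φ]
      rw [(toIcoMod_eq_self hp).2 ⟨hθ.1, by rwa [zero_add]⟩]
    · simp only [φ]
      have := toIcoMod_add_right hp 0 0
      rw [zero_add, toIcoMod_apply_left] at this
      rw [this, h0]
  have hbase : ∀ θ ∈ Icc 0 p, HasDerivWithinAt φ (f θ (φ θ)) (Icc 0 p) θ := fun θ hθ => by
    rw [hφr θ hθ]
    exact (hr θ hθ).congr hφr (hφr θ hθ)
  have hmain : ∀ θ ∈ Ico 0 p, HasDerivAt φ (f θ (φ θ)) θ := by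
    intro θ hθ
    rcases hθ.1.lt_or_eq with h | rfl
    · exact (hbase θ ⟨h.le, hθ.2.le⟩).hasDerivAt (Icc_mem_nhds h hθ.2)
    -- At the junction the right derivative is read off at `0` and the left derivative at `p`;
    -- periodicity of `f` and `φ` makes them agree.
    · have h1 : HasDerivWithinAt φ (f 0 (φ 0)) (Ici 0) 0 :=
        (hbase 0 ⟨le_rfl, hp.le⟩).mono_of_mem_nhdsWithin (Icc_mem_nhdsGE hp)
      have h2 : HasDerivWithinAt φ (f p (φ p)) (Iic p) p :=
        (hbase p ⟨hp.le, le_rfl⟩).mono_of_mem_nhdsWithin (Icc_mem_nhdsLE hp)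
      have hfp : f p (φ p) = f 0 (φ 0) := by
        have e1 : φ p = φ 0 := by simpa using hφper 0
        have e2 : f p (φ 0) = f 0 (φ 0) := by simpa using hper (φ 0) 0
        rw [e1, e2]
      rw [hfp] at h2
      have h3 : HasDerivWithinAt φ (f 0 (φ 0)) (Iic 0) 0 := by
        have hs : HasDerivWithinAt (fun θ : ℝ => θ + p) 1 (Iic 0) 0 :=
          ((hasDerivAt_id 0).add_const p).hasDerivWithinAt
        have h2' : HasDerivWithinAt φ (f 0 (φ 0)) (Iic p) (0 + p) := by rwa [zero_add]
        have := h2'.scomp (0 : ℝ) hs (fun θ (hθ : θ ≤ 0) => by simpa using hθ)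
        rw [one_smul] at this
        refine this.congr (fun θ _ => (hφper θ).symm) (hφper 0).symm
      have := h3.union h1
      rwa [Iic_union_Ici, hasDerivWithinAt_univ] at this
  refine ⟨φ, hφper, fun θ => ?_, fun θ => ⟨_, Ico_subset_Icc_self (hmem θ), rfl⟩⟩
  have hk : θ - toIcoDiv hp 0 θ • p = toIcoMod hp 0 θ := rfl
  have h1 := hmain _ (hmem θ)
  rw [← hk] at h1
  have h2 := HasDerivAt.comp_sub_const (a := toIcoDiv hp 0 θ • p) (x := θ) h1
  have e1 : (fun x => φ (x - toIcoDiv hp 0 θ • p)) = φ := funext fun x => hφper.sub_zsmul_eq _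
  have e2 : φ (θ - toIcoDiv hp 0 θ • p) = φ θ := hφper.sub_zsmul_eq _
  have e3 : f (θ - toIcoDiv hp 0 θ • p) (φ θ) = f θ (φ θ) := (hper (φ θ)).sub_zsmul_eq _
  rwa [e1, e2, e3] at h2

/-- Existence of a periodic solution of a scalar periodic equation from a change of sign of the
displacement map. -/
theorem exists_periodic_solution {f : ℝ → ℝ → ℝ} {p ρ δ K L σ : ℝ} (hp : 0 < p) (hδ : 0 < δ)
    (hper : ∀ r, Function.Periodic (fun θ => f θ r) p)
    (hcont : ∀ r ∈ Icc (ρ - δ) (ρ + δ), Continuous fun θ => f θ r)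
    (hlip : ∀ θ, ∀ r ∈ Icc (ρ - δ) (ρ + δ), ∀ r' ∈ Icc (ρ - δ) (ρ + δ),
      |f θ r - f θ r'| ≤ K * |r - r'|)
    (hbd : ∀ θ, ∀ r ∈ Icc (ρ - δ) (ρ + δ), |f θ r| ≤ L) (hL : L * p ≤ δ / 2)
    (hdis : ∀ r : ℝ → ℝ, (∀ θ ∈ Icc 0 p, HasDerivWithinAt r (f θ (r θ)) (Icc 0 p) θ) →
      (∀ θ ∈ Icc 0 p, r θ ∈ Icc (ρ - δ) (ρ + δ)) → (∀ θ ∈ Icc 0 p, |r θ - r 0| ≤ L * p) →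
      (r 0 = ρ - δ / 2 → σ * (r p - r 0) < 0) ∧ (r 0 = ρ + δ / 2 → 0 < σ * (r p - r 0))) :
    ∃ φ : ℝ → ℝ, Function.Periodic φ p ∧ (∀ θ, HasDerivAt φ (f θ (φ θ)) θ) ∧
      ∀ θ, φ θ ∈ Icc (ρ - δ) (ρ + δ) := by
  have hle : ρ - δ ≤ ρ + δ := by linarith
  -- Clamping `r` to the strip makes the right-hand side globally bounded and Lipschitz. Solutions
  -- from the inner half of the strip never leave it, since they move by at most `L * p ≤ δ / 2`, so
  -- they solve the original equation.
  let π' : ℝ → ℝ := fun r => projIcc (ρ - δ) (ρ + δ) hle r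
  have hπmem : ∀ r, π' r ∈ Icc (ρ - δ) (ρ + δ) := fun r => (projIcc _ _ hle r).2
  have hπid : ∀ r ∈ Icc (ρ - δ) (ρ + δ), π' r = r := fun r hr => by
    simp only [π', projIcc_of_mem hle hr]
  have hπlip : ∀ r r', |π' r - π' r'| ≤ |r - r'| := fun r r' => by
    have := (LipschitzWith.projIcc hle).dist_le_mul r r'
    simpa [Real.dist_eq, Subtype.dist_eq] using this
  let g : ℝ → ℝ → ℝ := fun θ r => f θ (π' r)
  have hL0 : 0 ≤ L := (abs_nonneg _).trans (hbd 0 ρ ⟨by linarith, by linarith⟩)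
  have hK0 : 0 ≤ K := by
    have h := (abs_nonneg _).trans
      (hlip 0 (ρ + δ) ⟨by linarith, by linarith⟩ ρ ⟨by linarith, by linarith⟩)
    have hpos : 0 < |ρ + δ - ρ| := by rw [add_sub_cancel_left]; exact abs_pos.2 hδ.ne'
    exact nonneg_of_mul_nonneg_left h hpos
  have hPL : IsPicardLindelof g (tmin := 0) (tmax := p) ⟨0, le_rfl, hp.le⟩ ρ
      ⟨L * p + δ / 2, by positivity⟩ ⟨δ / 2, by positivity⟩ ⟨L, hL0⟩ ⟨K, hK0⟩ := by
    refine ⟨fun θ _ => ?_, fun r _ => (hcont _ (hπmem r)).continuousOn,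
      fun θ _ r _ => hbd θ _ (hπmem r), ?_⟩
    swap
    · change L * max (p - 0) (0 - 0) ≤ L * p + δ / 2 - δ / 2
      rw [sub_zero, sub_zero, max_eq_left hp.le, add_sub_cancel_right]
    refine LipschitzWith.lipschitzOnWith (LipschitzWith.of_dist_le_mul fun r r' => ?_)
    rw [Real.dist_eq, Real.dist_eq]
    exact (hlip θ _ (hπmem r) _ (hπmem r')).trans (mul_le_mul_of_nonneg_left (hπlip r r') hK0)
  obtain ⟨a, ha, K', hK'⟩ :=
    hPL.exists_forall_mem_closedBall_eq_hasDerivWithinAt_lipschitzOnWith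
  have hball : ∀ x ∈ Icc (ρ - δ / 2) (ρ + δ / 2),
      x ∈ Metric.closedBall ρ ((⟨δ / 2, by positivity⟩ : NNReal) : ℝ) := fun x hx => by
    rw [Real.closedBall_eq_Icc]; exact hx
  have hstay : ∀ x ∈ Icc (ρ - δ / 2) (ρ + δ / 2), ∀ θ ∈ Icc 0 p,
      |a x θ - x| ≤ L * p := by
    intro x hx θ hθ
    obtain ⟨h0, h1⟩ := ha x (hball x hx)
    have := (convex_Icc 0 p).norm_image_sub_le_of_norm_hasDerivWithin_le (C := L) (x := 0) (y := θ)
      h1 (fun θ _ => hbd θ _ (hπmem _)) ⟨le_rfl, hp.le⟩ hθ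
    simp only at h0
    rw [h0, norm_eq_abs, norm_eq_abs, sub_zero, abs_of_nonneg hθ.1] at this
    exact this.trans (mul_le_mul_of_nonneg_left hθ.2 hL0)
  have hin : ∀ x ∈ Icc (ρ - δ / 2) (ρ + δ / 2), ∀ θ ∈ Icc 0 p,
      a x θ ∈ Icc (ρ - δ) (ρ + δ) := fun x hx θ hθ => by
    have := abs_le.1 (hstay x hx θ hθ)
    exact ⟨by linarith [hx.1, this.1], by linarith [hx.2, this.2]⟩
  have hsol : ∀ x ∈ Icc (ρ - δ / 2) (ρ + δ / 2), ∀ θ ∈ Icc 0 p,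
      HasDerivWithinAt (a x) (f θ (a x θ)) (Icc 0 p) θ := fun x hx θ hθ => by
    have := (ha x (hball x hx)).2 θ hθ
    simp only [g] at this
    rwa [hπid _ (hin x hx θ hθ)] at this
  have hinit : ∀ x ∈ Icc (ρ - δ / 2) (ρ + δ / 2), a x 0 = x := fun x hx => (ha x (hball x hx)).1
  have hdisp : ∀ x ∈ Icc (ρ - δ / 2) (ρ + δ / 2), _ := fun x hx =>
    hdis (a x) (hsol x hx) (hin x hx) (by rw [hinit x hx]; exact hstay x hx)
  have hle' : ρ - δ / 2 ≤ ρ + δ / 2 := by linarith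
  have hDc : ContinuousOn (fun x => σ * (a x p - x)) (Icc (ρ - δ / 2) (ρ + δ / 2)) := by
    have h := (hK' p ⟨hp.le, le_rfl⟩).continuousOn.mono hball
    exact continuousOn_const.mul (h.sub continuousOn_id)
  have hlo := (hdisp _ ⟨le_rfl, hle'⟩).1 (hinit _ ⟨le_rfl, hle'⟩)
  have hhi := (hdisp _ ⟨hle', le_rfl⟩).2 (hinit _ ⟨hle', le_rfl⟩)
  rw [hinit _ ⟨le_rfl, hle'⟩] at hlo
  rw [hinit _ ⟨hle', le_rfl⟩] at hhi
  obtain ⟨x, hx, hx0⟩ := intermediate_value_Icc hle' hDc ⟨hlo.le, hhi.le⟩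
  have hσ : σ ≠ 0 := by rintro rfl; simp at hlo
  have hx0' : a x p = a x 0 := by
    rw [hinit x hx]
    exact sub_eq_zero.1 ((mul_eq_zero.1 hx0).resolve_left hσ)
  obtain ⟨φ, h1, h2, h3⟩ := exists_periodic_extension hp hper (hsol x hx) hx0'
  refine ⟨φ, h1, h2, fun θ => ?_⟩
  obtain ⟨θ', hθ', h⟩ := h3 θ
  rw [h]
  exact hin x hx θ' hθ'

/-- Since `f x - c * x` is monotone, `f` tends to `±∞` at `±∞`. -/
theorem surjective_of_le_hasDerivAt {f f' : ℝ → ℝ} {c : ℝ} (hc : 0 < c)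
    (hf : ∀ x, HasDerivAt f (f' x) x) (hf' : ∀ x, c ≤ f' x) : Function.Surjective f := by
  have hsub : ∀ x, HasDerivAt (fun x => f x - c * x) (f' x - c * 1) x := fun x =>
    (hf x).sub ((hasDerivAt_id x).const_mul c)
  have hmono : Monotone fun x => f x - c * x :=
    monotone_of_deriv_nonneg (fun x => (hsub x).differentiableAt) fun x => by
      rw [(hsub x).deriv]; linarith [hf' x]
  have hcont : Continuous f := continuous_iff_continuousAt.2 fun x => (hf x).continuousAt
  refine hcont.surjective ?_ ?_
  · refine Filter.tendsto_atTop_mono' _ ?_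
      (Filter.tendsto_atTop_add_const_left _ (f 0) (Filter.tendsto_id.const_mul_atTop hc))
    filter_upwards [Filter.eventually_ge_atTop 0] with x hx
    have := hmono hx
    simp only [mul_zero, sub_zero, id] at this ⊢
    linarith
  · refine Filter.tendsto_atBot_mono' _ ?_
      (Filter.tendsto_atBot_add_const_left _ (f 0) (Filter.tendsto_id.const_mul_atBot hc))
    filter_upwards [Filter.eventually_le_atBot 0] with x hx
    have := hmono hx
    simp only [mul_zero, sub_zero, id] at this ⊢
    linarith

/-- The flow of an equation `Θ' = q(Θ)` on the circle with `q` continuous and positive. -/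
theorem exists_circle_flow {q : ℝ → ℝ} {p : ℝ} (hp : 0 < p) (hq : Continuous q)
    (hper : Function.Periodic q p) (hlow : ∀ θ, 1 / 2 ≤ q θ) (hup : ∀ θ, q θ ≤ 2) :
    ∃ (Θ : ℝ → ℝ) (T : ℝ), 0 < T ∧ Θ 0 = 0 ∧ Θ T = p ∧ (∀ t, HasDerivAt Θ (q (Θ t)) t) ∧
      (∀ t, Θ (t + T) = Θ t + p) ∧ StrictMono Θ ∧ Function.Surjective Θ := by
  have hpos : ∀ θ, 0 < q θ := fun θ => by linarith [hlow θ]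
  have hinv : Continuous fun θ => (q θ)⁻¹ := hq.inv₀ fun θ => (hpos θ).ne'
  -- Time as a function of the angle; its inverse is the flow. This quadrature needs only continuity
  -- of `q`.
  let τ : ℝ → ℝ := fun θ => ∫ s in (0 : ℝ)..θ, (q s)⁻¹
  have hτ : ∀ θ, HasDerivAt τ (q θ)⁻¹ θ := hinv.hasDerivAt_primitive 0
  have hτ0 : τ 0 = 0 := intervalIntegral.integral_same
  have hmono : StrictMono τ := strictMono_of_deriv_pos fun θ => by
    rw [(hτ θ).deriv]; exact inv_pos.2 (hpos θ)
  have hsurj : Function.Surjective τ := by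
    refine surjective_of_le_hasDerivAt (c := 1 / 2) (by norm_num) hτ fun θ => ?_
    rw [one_div]
    exact inv_anti₀ (hpos θ) (hup θ)
  have hτp : ∀ θ, τ (θ + p) = τ θ + τ p := fun θ => by
    have h1 : Function.Periodic (fun s => (q s)⁻¹) p := fun s => by simp only [hper s]
    have h2 := h1.intervalIntegral_add_eq θ 0
    rw [zero_add] at h2
    simp only [τ]
    rw [← h2]
    exact (intervalIntegral.integral_add_adjacent_intervals (hinv.intervalIntegrable _ _)
      (hinv.intervalIntegrable _ _)).symm
  let e := hmono.orderIsoOfSurjective τ hsurj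
  have he : ∀ t, τ (e.symm t) = t := fun t => e.apply_symm_apply t
  have hes : ∀ θ, e.symm (τ θ) = θ := fun θ => e.symm_apply_apply θ
  refine ⟨e.symm, τ p, ?_, ?_, hes p, fun t => ?_, fun t => ?_, e.symm.strictMono, e.symm.surjective⟩
  · rw [← hτ0]; exact hmono hp
  · conv_rhs => rw [← hes 0, hτ0]
  · have := HasDerivAt.of_local_left_inverse (f := τ) (g := e.symm) (a := t)
      e.symm.continuous.continuousAt (hτ _) (inv_ne_zero (hpos _).ne')
      (Filter.Eventually.of_forall he)
    rwa [inv_inv] at this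
  · rw [← hes (e.symm t + p), hτp, he]

/-! ### Planar fields on an annulus and closed curves `r = φ(θ)`. -/

/-- The continuous planar field `v` reads `ṙ = P(r, θ)`, `θ̇ = Q(r, θ)` on an annulus, with angular
velocity between `1 / 2` and `2`. -/
structure IsAnnularField (v : ℝ × ℝ → ℝ × ℝ) (P Q : ℝ → ℝ → ℝ) (ρ δ : ℝ) : Prop where
  continuous : Continuous v
  pos : 0 < δ
  lt : δ < ρ
  polar : ∀ r ∈ Icc (ρ - δ) (ρ + δ), ∀ θ, v (polarPoint r θ) =
    (P r θ * cos θ - r * Q r θ * sin θ, P r θ * sin θ + r * Q r θ * cos θ)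
  half_le : ∀ r ∈ Icc (ρ - δ) (ρ + δ), ∀ θ, 1 / 2 ≤ Q r θ
  le_two : ∀ r ∈ Icc (ρ - δ) (ρ + δ), ∀ θ, Q r θ ≤ 2

namespace IsAnnularField

variable {v : ℝ × ℝ → ℝ × ℝ} {P Q : ℝ → ℝ → ℝ} {ρ δ : ℝ} (h : IsAnnularField v P Q ρ δ)
include h

theorem radius_pos {r : ℝ} (hr : r ∈ Icc (ρ - δ) (ρ + δ)) : 0 < r := by linarith [hr.1, h.lt]

/-- No regularity of `Q` is assumed; this formula lets it inherit continuity and periodicity along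
curves from `v`. -/
theorem angular_eq {r : ℝ} (hr : r ∈ Icc (ρ - δ) (ρ + δ)) (θ : ℝ) :
    Q r θ = ((v (polarPoint r θ)).2 * cos θ - (v (polarPoint r θ)).1 * sin θ) / r := by
  rw [h.polar r hr θ, eq_div_iff (h.radius_pos hr).ne']
  linear_combination (-(Q r θ * r)) * cos_sq_add_sin_sq θ

theorem radial_eq {r : ℝ} (hr : r ∈ Icc (ρ - δ) (ρ + δ)) (θ : ℝ) :
    P r θ = (v (polarPoint r θ)).1 * cos θ + (v (polarPoint r θ)).2 * sin θ := by
  rw [h.polar r hr θ]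
  linear_combination (-(P r θ)) * cos_sq_add_sin_sq θ

/-- A periodic solution `φ` of `dr/dθ = P/Q` gives a periodic solution of the planar equation. -/
theorem exists_isPeriodicSolution {φ : ℝ → ℝ} (hper : Function.Periodic φ (2 * π))
    (hφ : ∀ θ, HasDerivAt φ (P (φ θ) θ / Q (φ θ) θ) θ) (hmem : ∀ θ, φ θ ∈ Icc (ρ - δ) (ρ + δ)) :
    ∃ (Θ : ℝ → ℝ) (T : ℝ), IsPeriodicSolution v (fun t => polarPoint (φ (Θ t)) (Θ t)) T ∧
      Θ 0 = 0 ∧ Θ T = 2 * π ∧ (∀ t, HasDerivAt Θ (Q (φ (Θ t)) (Θ t)) t) ∧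
      Continuous (fun t => Q (φ (Θ t)) (Θ t)) ∧ Function.Surjective Θ := by
  have hφc : Continuous φ := continuous_iff_continuousAt.2 fun θ => (hφ θ).continuousAt
  have hqper : Function.Periodic (fun θ => Q (φ θ) θ) (2 * π) := fun θ => by
    have hp : polarPoint (φ θ) (θ + 2 * π) = polarPoint (φ θ) θ := by simp [polarPoint]
    simp only [h.angular_eq (hmem _), hper θ, hp, cos_add_two_pi, sin_add_two_pi]
  have hqc : Continuous fun θ => Q (φ θ) θ := by
    have hvc := h.continuous.comp (continuous_polarPoint hφc continuous_id)
    simp only [h.angular_eq (hmem _)]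
    refine Continuous.div ?_ hφc fun θ => (h.radius_pos (hmem θ)).ne'
    exact (hvc.snd.mul continuous_cos).sub (hvc.fst.mul continuous_sin)
  obtain ⟨Θ, T, hT, hΘ0, hΘT, hΘ, hadd, hΘm, hΘs⟩ := exists_circle_flow two_pi_pos hqc hqper
    (fun θ => h.half_le _ (hmem θ) θ) (fun θ => h.le_two _ (hmem θ) θ)
  refine ⟨Θ, T, ⟨fun t => ?_, hT, fun t => ?_, fun s hs hsper => ?_⟩, hΘ0, hΘT, hΘ,
    hqc.comp (continuous_iff_continuousAt.2 fun t => (hΘ t).continuousAt), hΘs⟩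
  · have h1 := hasDerivAt_polarPoint ((hφ (Θ t)).comp t (hΘ t)) (hΘ t)
    refine h1.congr_deriv ?_
    have hQ : Q (φ (Θ t)) (Θ t) ≠ 0 := by linarith [h.half_le _ (hmem (Θ t)) (Θ t)]
    rw [h.polar _ (hmem _)]
    simp only [Function.comp_apply, div_mul_cancel₀ _ hQ]
  · have := polarPoint_add_int_mul (φ (Θ t)) (Θ t) 1
    rw [Int.cast_one, one_mul] at this
    simp only [hadd t, hper (Θ t), this]
  -- Any positive period `s` returns to the starting ray, so `Θ s` is a positive multiple of `2π`,
  -- hence at least `Θ T`.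
  · have h0 := hsper 0
    simp only [zero_add] at h0
    obtain ⟨k, hk⟩ := eq_add_int_mul_of_polarPoint_eq (h.radius_pos (hmem _))
      (h.radius_pos (hmem _)) h0
    rw [hΘ0, zero_add] at hk
    have hpos : 0 < Θ s := hΘ0 ▸ hΘm hs
    rw [hk] at hpos
    have hk1 : (1 : ℤ) ≤ k := by
      have : (0 : ℝ) < k := pos_of_mul_pos_left hpos two_pi_pos.le
      exact_mod_cast this
    have hk1' : (1 : ℝ) ≤ k := by exact_mod_cast hk1
    refine hΘm.le_iff_le.1 ?_
    rw [hΘT, hk]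
    nlinarith [two_pi_pos]

/-- A periodic orbit on the closed curve `r = φ(θ)` is the whole curve. -/
theorem range_eq_of_subset {φ : ℝ → ℝ} (hper : Function.Periodic φ (2 * π))
    (hmem : ∀ θ, φ θ ∈ Icc (ρ - δ) (ρ + δ)) {γ : ℝ → ℝ × ℝ}
    (hγ : ∀ t, HasDerivAt γ (v (γ t)) t)
    (hsub : ∀ t, radius (γ t) = φ (angleNear 0 (γ t))) :
    range γ = range fun θ => polarPoint (φ θ) θ := by
  have hγc : Continuous γ := continuous_iff_continuousAt.2 fun t => (hγ t).continuousAt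
  have hrm : ∀ t, radius (γ t) ∈ Icc (ρ - δ) (ρ + δ) := fun t => hsub t ▸ hmem _
  have hrp : ∀ t, 0 < radius (γ t) := fun t => h.radius_pos (hrm t)
  have hsq : ∀ t, radius (γ t) ^ 2 = (γ t).1 ^ 2 + (γ t).2 ^ 2 := fun t =>
    sq_sqrt (by positivity)
  have hrc : Continuous fun t => radius (γ t) ^ 2 := (continuous_radius.comp hγc).pow 2
  have hvc : Continuous fun t => v (γ t) := h.continuous.comp hγc
  -- `κ` and `ω` are the logarithmic radial and the angular velocities. As `ω ≥ 1/2`, the lifted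
  -- angle covers the line, so the orbit covers the whole curve.
  let κ : ℝ → ℝ := fun t =>
    ((γ t).1 * (v (γ t)).1 + (γ t).2 * (v (γ t)).2) / radius (γ t) ^ 2
  let ω : ℝ → ℝ := fun t =>
    ((γ t).1 * (v (γ t)).2 - (γ t).2 * (v (γ t)).1) / radius (γ t) ^ 2
  have hκ : Continuous κ := ((hγc.fst.mul hvc.fst).add (hγc.snd.mul hvc.snd)).div hrc
    fun t => (pow_pos (hrp t) 2).ne'
  have hω : Continuous ω := ((hγc.fst.mul hvc.snd).sub (hγc.snd.mul hvc.fst)).div hrc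
    fun t => (pow_pos (hrp t) 2).ne'
  have hω2 : ∀ t, 1 / 2 ≤ ω t := fun t => by
    have h1 := h.half_le _ (hrm t) (angleNear 0 (γ t))
    rw [h.angular_eq (hrm t), polarPoint_angleNear] at h1
    refine h1.trans_eq ?_
    have e := polarPoint_angleNear 0 (γ t)
    have e1 : (γ t).1 = radius (γ t) * cos (angleNear 0 (γ t)) := (congrArg Prod.fst e).symm
    have e2 : (γ t).2 = radius (γ t) * sin (angleNear 0 (γ t)) := (congrArg Prod.snd e).symm
    have hne := (hrp t).ne'
    simp only [ω]
    rw [div_eq_div_iff hne (pow_ne_zero 2 hne)]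
    generalize hw : v (γ t) = w
    rw [e1, e2]
    have : radius (γ t) ≠ 0 := hne
    generalize radius (γ t) = R at *
    ring
  let Θ : ℝ → ℝ := fun t => angleNear 0 (γ 0) + ∫ s in (0 : ℝ)..t, ω s
  have hΘ : ∀ t, HasDerivAt Θ (ω t) t := fun t => (hω.hasDerivAt_primitive 0 t).const_add _
  have hΘ0 : Θ 0 = angleNear 0 (γ 0) := by simp [Θ]
  have hpol := eq_polarPoint_of_angular_velocity (γ := γ) hκ (fun t => by
    refine (hγ t).congr_deriv ?_
    have hne : radius (γ t) ^ 2 ≠ 0 := (pow_pos (hrp t) 2).ne'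
    have hs := hsq t
    simp only [κ, ω]
    refine Prod.ext ?_ ?_ <;> simp only
    · rw [div_mul_eq_mul_div, div_mul_eq_mul_div, ← sub_div, eq_div_iff hne, hs]; ring
    · rw [div_mul_eq_mul_div, div_mul_eq_mul_div, ← add_div, eq_div_iff hne, hs]; ring) hΘ
    (by rw [hΘ0, polarPoint_angleNear])
  have hpol' : ∀ t, γ t = polarPoint (φ (Θ t)) (Θ t) := fun t => by
    have e : φ (angleNear 0 (γ t)) = φ (Θ t) := hper.eq_of_polarPoint_eq (hrp t) (hrp t)
      (by rw [polarPoint_angleNear]; exact hpol t)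
    rw [← e, ← hsub t]
    exact hpol t
  have : γ = (fun θ => polarPoint (φ θ) θ) ∘ Θ := funext hpol'
  rw [this, (surjective_of_le_hasDerivAt (by norm_num) hΘ hω2).range_comp]

end IsAnnularField

/-! ### Isolation of the closed curve by a monotone tube function. -/

theorem HasDerivAt.eventually_lt_right {f : ℝ → ℝ} {d x : ℝ} (hf : HasDerivAt f d x) (hd : d < 0) :
    ∀ᶠ y in 𝓝[>] x, f y < f x := by
  have h := (hasDerivAt_iff_tendsto_slope.1 hf).eventually (gt_mem_nhds hd)
  have h' : ∀ᶠ y in 𝓝[>] x, slope f x y < 0 := h.filter_mono (nhdsWithin_mono x fun y hy => ne_of_gt hy)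
  filter_upwards [h', self_mem_nhdsWithin] with y hy hxy
  rw [slope_def_field, div_lt_iff₀ (sub_pos.2 hxy), zero_mul] at hy
  linarith

/-- A nonnegative periodic function that strictly decreases wherever it takes values in `(0, η)`
does not take such values. -/
theorem Function.Periodic.eq_zero_of_decreasing {f : ℝ → ℝ} {p η : ℝ} (hp : 0 < p)
    (hper : Function.Periodic f p) (hnn : ∀ t, 0 ≤ f t)
    (hcl : ∀ c < η, IsClosed {t | f t ≤ c})
    (hder : ∀ t, f t < η → ∃ d, HasDerivAt f d t ∧ d ≤ 0 ∧ (f t ≠ 0 → d < 0)) {t₀ : ℝ}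
    (ht₀ : f t₀ < η) : f t₀ = 0 := by
  by_contra hne
  have hpos : 0 < f t₀ := lt_of_le_of_ne (hnn t₀) (Ne.symm hne)
  -- Continuous induction on the interval: differentiability and decrease are known only where `f <
  -- η`, so the bound by `f t₀` has to be propagated to the right before monotonicity over a full
  -- period can be used.
  have hsub : Icc t₀ (t₀ + p) ⊆ {t | f t ≤ f t₀} := by
    refine IsClosed.Icc_subset_of_forall_mem_nhdsWithin ((hcl _ ht₀).inter isClosed_Icc)
      (le_refl (f t₀)) fun x hx => ?_
    have hx1 : f x ≤ f t₀ := hx.1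
    obtain ⟨d, hd, -, hd2⟩ := hder x (hx1.trans_lt ht₀)
    by_cases hx0 : f x = 0
    · have := hd.continuousAt.eventually (gt_mem_nhds (hx0 ▸ hpos : f x < f t₀))
      exact (this.filter_mono nhdsWithin_le_nhds).mono fun y hy => hy.le
    · exact (hd.eventually_lt_right (hd2 hx0)).mono fun y hy => hy.le.trans hx1
  have hlt : ∀ x ∈ Icc t₀ (t₀ + p), f x < η := fun x hx => (hsub hx).trans_lt ht₀
  have hanti : AntitoneOn f (Icc t₀ (t₀ + p)) := by
    refine antitoneOn_of_deriv_nonpos (convex_Icc _ _) (fun x hx => ?_) (fun x hx => ?_)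
      (fun x hx => ?_)
    · obtain ⟨d, hd, -⟩ := hder x (hlt x hx)
      exact hd.continuousAt.continuousWithinAt
    · obtain ⟨d, hd, -⟩ := hder x (hlt x (interior_subset hx))
      exact hd.differentiableAt.differentiableWithinAt
    · obtain ⟨d, hd, h, -⟩ := hder x (hlt x (interior_subset hx))
      rwa [hd.deriv]
  obtain ⟨d, hd, -, hd2⟩ := hder t₀ ht₀
  have hmem : ∀ᶠ y in 𝓝[>] t₀, y ∈ Ioo t₀ (t₀ + p) := Ioo_mem_nhdsGT (by linarith)
  obtain ⟨y, hy, hyI⟩ := ((hd.eventually_lt_right (hd2 hne)).and hmem).exists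
  have h1 := hanti (Ioo_subset_Icc_self hyI) ⟨by linarith, le_rfl⟩ hyI.2.le
  rw [hper t₀] at h1
  linarith

theorem Function.Periodic.exists_abs_le {g : ℝ → ℝ} {p : ℝ} (hper : Function.Periodic g p)
    (hp : 0 < p) (hg : Continuous g) : ∃ B, ∀ θ, |g θ| ≤ B := by
  obtain ⟨B, hB⟩ := isCompact_Icc.exists_bound_of_continuousOn (s := Icc 0 p) hg.continuousOn
  refine ⟨B, fun θ => ?_⟩
  obtain ⟨y, hy, h⟩ := hper.exists_mem_Ico₀ hp θ
  rw [h]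
  exact hB y (Ico_subset_Icc_self hy)

/-- The square of the distance to the curve `r = φ(θ)`, with the weight `e^{-2 g(θ)}`. -/
def tubeFunction (φ g : ℝ → ℝ) (p : ℝ × ℝ) : ℝ :=
  ((radius p - φ (angleNear 0 p)) * exp (-g (angleNear 0 p))) ^ 2

theorem tubeFunction_eq {φ g : ℝ → ℝ} (hφ : Function.Periodic φ (2 * π))
    (hg : Function.Periodic g (2 * π)) {p : ℝ × ℝ} (hp : 0 < radius p) (θ₀ : ℝ) :
    tubeFunction φ g p = ((radius p - φ (angleNear θ₀ p)) * exp (-g (angleNear θ₀ p))) ^ 2 := by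
  rw [tubeFunction, hφ.angleNear_eq hp 0 θ₀, hg.angleNear_eq hp 0 θ₀]

/-- `angleNear 0` jumps across its cut, but periodicity allows the branch centred at the angle of
`p`, which is continuous near `p`. -/
theorem continuousAt_tubeFunction {φ g : ℝ → ℝ} (hφ : Function.Periodic φ (2 * π))
    (hg : Function.Periodic g (2 * π)) (hφc : Continuous φ) (hgc : Continuous g) {p : ℝ × ℝ}
    (hp : 0 < radius p) : ContinuousAt (tubeFunction φ g) p := by
  have ha : ContinuousAt (angleNear (angleNear 0 p)) p := by
    have := continuousAt_angleNear hp (angleNear 0 p)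
    rwa [polarPoint_angleNear] at this
  have h : ContinuousAt (fun q => ((radius q - φ (angleNear (angleNear 0 p) q)) *
      exp (-g (angleNear (angleNear 0 p) q))) ^ 2) p :=
    ((continuous_radius.continuousAt.sub (hφc.continuousAt.comp ha)).mul
      (continuous_exp.continuousAt.comp (hgc.continuousAt.comp ha).neg)).pow 2
  refine h.congr ?_
  filter_upwards [continuous_radius.continuousAt.eventually (lt_mem_nhds hp)] with q hq
  exact (tubeFunction_eq hφ hg hq _).symm

theorem abs_lt_of_tubeFunction_lt {φ g : ℝ → ℝ} {B s : ℝ} (hB : ∀ θ, |g θ| ≤ B) (hs : 0 < s)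
    {p : ℝ × ℝ} (h : tubeFunction φ g p < (s * exp (-B)) ^ 2) :
    |radius p - φ (angleNear 0 p)| < s := by
  have h1 := abs_lt_of_sq_lt_sq h (by positivity)
  rw [abs_mul, abs_of_pos (exp_pos _)] at h1
  have h2 : exp (-B) ≤ exp (-g (angleNear 0 p)) :=
    exp_le_exp.2 (neg_le_neg ((le_abs_self _).trans (hB _)))
  by_contra hcon
  push Not at hcon
  exact absurd h1 (not_lt.2 (mul_le_mul hcon h2 (exp_pos _).le (abs_nonneg _)))

theorem tubeFunction_eq_zero_iff {φ g : ℝ → ℝ} {p : ℝ × ℝ} :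
    tubeFunction φ g p = 0 ↔ radius p = φ (angleNear 0 p) := by
  rw [tubeFunction, sq_eq_zero_iff, mul_eq_zero, or_iff_left (exp_ne_zero _), sub_eq_zero]

namespace IsAnnularField

variable {v : ℝ × ℝ → ℝ × ℝ} {P Q : ℝ → ℝ → ℝ} {ρ δ : ℝ} (h : IsAnnularField v P Q ρ δ)
include h

/-- Chain rule in the branch centred at `θ`, with `ṙ = P` and `θ̇ = Q`. Factoring out `Q` leaves the
difference of `dr/dθ` on the orbit and on the curve, corrected by the weight. -/
theorem hasDerivAt_tubeFunction {φ g g' : ℝ → ℝ} (hφper : Function.Periodic φ (2 * π))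
    (hgper : Function.Periodic g (2 * π))
    (hφ : ∀ θ, HasDerivAt φ (P (φ θ) θ / Q (φ θ) θ) θ) (hg : ∀ θ, HasDerivAt g (g' θ) θ)
    {γ : ℝ → ℝ × ℝ} {t : ℝ} (hγ : HasDerivAt γ (v (γ t)) t) {r θ : ℝ}
    (hr : r ∈ Icc (ρ - δ) (ρ + δ)) (hrθ : γ t = polarPoint r θ) :
    HasDerivAt (fun s => tubeFunction φ g (γ s))
      (2 * exp (-g θ) ^ 2 * Q r θ *
        ((r - φ θ) * (P r θ / Q r θ - P (φ θ) θ / Q (φ θ) θ - (r - φ θ) * g' θ))) t := by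
  have hr0 := h.radius_pos hr
  have hQ : Q r θ ≠ 0 := by linarith [h.half_le _ hr θ]
  have ha := hasDerivAt_angleNear hγ hr0 hrθ
  have hrad := hasDerivAt_radius hγ hr0 hrθ
  rw [hrθ, ← h.angular_eq hr] at ha
  rw [hrθ, ← h.radial_eq hr] at hrad
  have haθ : angleNear θ (γ t) = θ := by rw [hrθ, angleNear_polarPoint hr0.le]
  have hrr : radius (γ t) = r := by rw [hrθ, radius_polarPoint hr0.le]
  have h1 : HasDerivAt (fun s => φ (angleNear θ (γ s))) (P (φ θ) θ / Q (φ θ) θ * Q r θ) t := by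
    have := HasDerivAt.comp t (h₂ := φ) (h := fun s => angleNear θ (γ s)) (by rw [haθ]; exact hφ θ) ha
    exact this
  have h2 : HasDerivAt (fun s => g (angleNear θ (γ s))) (g' θ * Q r θ) t := by
    have := HasDerivAt.comp t (h₂ := g) (h := fun s => angleNear θ (γ s)) (by rw [haθ]; exact hg θ) ha
    exact this
  have h3 := ((hrad.sub h1).mul h2.neg.exp).pow 2
  have h4 := h3.congr_of_eventuallyEq (f₁ := fun s => tubeFunction φ g (γ s)) (by
    have : 0 < radius (γ t) := hrr ▸ hr0
    filter_upwards [(continuous_radius.continuousAt.comp hγ.continuousAt).eventually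
      (lt_mem_nhds this)] with s hs
    exact tubeFunction_eq hφper hgper hs θ)
  refine h4.congr_deriv ?_
  simp only [Pi.sub_apply, Pi.mul_apply, Pi.neg_apply, haθ, hrr]
  field_simp
  norm_num
  ring

/-- If the weighted distance to the periodic solution `φ` is strictly monotone along the orbits near
it, then the orbit `r = φ(θ)` is a limit cycle. -/
theorem isLimitCycle {φ g g' : ℝ → ℝ} {σ : ℝ} (hφper : Function.Periodic φ (2 * π))
    (hgper : Function.Periodic g (2 * π))
    (hφ : ∀ θ, HasDerivAt φ (P (φ θ) θ / Q (φ θ) θ) θ) (hg : ∀ θ, HasDerivAt g (g' θ) θ)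
    (hmem : ∀ θ, φ θ ∈ Icc (ρ - δ / 2) (ρ + δ / 2)) (hσ : σ ≠ 0)
    (hcontr : ∀ r ∈ Icc (ρ - δ) (ρ + δ), ∀ θ, r ≠ φ θ →
      0 < σ * ((r - φ θ) * (P r θ / Q r θ - P (φ θ) θ / Q (φ θ) θ - (r - φ θ) * g' θ))) :
    IsLimitCycle v (range fun θ => polarPoint (φ θ) θ) := by
  have hδ := h.pos
  have hρ := h.lt
  have hmem' : ∀ θ, φ θ ∈ Icc (ρ - δ) (ρ + δ) := fun θ =>
    ⟨by linarith [(hmem θ).1], by linarith [(hmem θ).2]⟩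
  have hφc : Continuous φ := continuous_iff_continuousAt.2 fun θ => (hφ θ).continuousAt
  have hgc : Continuous g := continuous_iff_continuousAt.2 fun θ => (hg θ).continuousAt
  obtain ⟨B, hB⟩ := hgper.exists_abs_le two_pi_pos hgc
  -- Since `|g| ≤ B`, this level keeps the tube within `δ / 2` of the curve, hence inside the
  -- annulus.
  set η : ℝ := (δ / 2 * exp (-B)) ^ 2 with hη
  have hηpos : 0 < η := by positivity
  have hstrip : ∀ p, tubeFunction φ g p < η → radius p ∈ Icc (ρ - δ) (ρ + δ) := fun p hp => by
    have h1 := abs_lt.1 (abs_lt_of_tubeFunction_lt hB (by positivity) hp)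
    have h2 := hmem (angleNear 0 p)
    exact ⟨by linarith [h1.1, h2.1], by linarith [h1.2, h2.2]⟩
  have hVat : ∀ p, 0 < radius p → ContinuousAt (tubeFunction φ g) p := fun p hp =>
    continuousAt_tubeFunction hφper hgper hφc hgc hp
  have hopen : IsOpen {p | tubeFunction φ g p < η} := by
    have h1 : IsOpen {p : ℝ × ℝ | 0 < radius p} := isOpen_lt continuous_const continuous_radius
    have h2 : ContinuousOn (tubeFunction φ g) {p | 0 < radius p} := fun p hp =>
      (hVat p hp).continuousWithinAt
    convert h2.isOpen_inter_preimage h1 (isOpen_Iio (a := η)) using 1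
    ext p
    exact ⟨fun hp => ⟨h.radius_pos (hstrip p hp), hp⟩, fun hp => hp.2⟩
  -- Continuity of the tube function is available only off the origin; its low sublevel sets are
  -- closed in the plane because they stay outside the inner disc.
  have hclosed : ∀ c < η, IsClosed {p | tubeFunction φ g p ≤ c} := fun c hc => by
    have h1 : IsClosed {p : ℝ × ℝ | ρ - δ ≤ radius p} :=
      isClosed_le continuous_const continuous_radius
    have h2 : ContinuousOn (tubeFunction φ g) {p | ρ - δ ≤ radius p} := fun p hp =>
      (hVat p (lt_of_lt_of_le (by linarith) hp)).continuousWithinAt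
    convert h2.preimage_isClosed_of_isClosed h1 (isClosed_Iic (a := c)) using 1
    ext p
    exact ⟨fun hp => ⟨(hstrip p (lt_of_le_of_lt hp hc)).1, hp⟩, fun hp => hp.2⟩
  have hder : ∀ (γ : ℝ → ℝ × ℝ), (∀ t, HasDerivAt γ (v (γ t)) t) → ∀ t,
      tubeFunction φ g (γ t) < η → ∃ d, HasDerivAt (fun s => tubeFunction φ g (γ s)) d t ∧
        0 ≤ σ * d ∧ (tubeFunction φ g (γ t) ≠ 0 → 0 < σ * d) := by
    intro γ hγ t ht
    have hr := hstrip _ ht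
    refine ⟨_, h.hasDerivAt_tubeFunction hφper hgper hφ hg (hγ t) hr
      (polarPoint_angleNear 0 (γ t)).symm, ?_⟩
    generalize hθ : angleNear 0 (γ t) = θ
    generalize hrr : radius (γ t) = r at hr
    have hpos : 0 < 2 * exp (-g θ) ^ 2 * Q r θ := by
      have := h.half_le r hr θ
      positivity
    have hlt : r ≠ φ θ → 0 < σ * (2 * exp (-g θ) ^ 2 * Q r θ *
        ((r - φ θ) * (P r θ / Q r θ - P (φ θ) θ / Q (φ θ) θ - (r - φ θ) * g' θ))) := fun hne => by
      rw [mul_left_comm]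
      exact mul_pos hpos (hcontr r hr θ hne)
    refine ⟨?_, fun hne => hlt fun heq => hne ?_⟩
    · by_cases heq : r = φ θ
      · rw [sub_eq_zero.2 heq]; simp
      · exact (hlt heq).le
    · rw [tubeFunction_eq_zero_iff, hθ, hrr, heq]
  have htrap : ∀ (γ : ℝ → ℝ × ℝ) (T : ℝ), IsPeriodicSolution v γ T → ∀ t,
      tubeFunction φ g (γ t) < η → tubeFunction φ g (γ t) = 0 := by
    intro γ T hγ t ht
    have hγc : Continuous γ := continuous_iff_continuousAt.2 fun t => (hγ.hasDerivAt t).continuousAt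
    have hper : Function.Periodic (fun s => tubeFunction φ g (γ s)) T := fun s => by
      simp only [hγ.periodic s]
    -- For `σ < 0` the tube function decreases along orbits; for `σ > 0` it increases, and time is
    -- reversed.
    rcases lt_or_gt_of_ne hσ with hσ | hσ
    · refine Function.Periodic.eq_zero_of_decreasing
        (f := fun s => -(-(tubeFunction φ g (γ s)))) (p := T) (η := η) hγ.pos ?_ ?_ ?_ ?_
        (t₀ := t) (by simpa using ht) |> fun h => by simpa using h
      all_goals simp only [neg_neg]
      · exact hper
      · exact fun s => sq_nonneg _
      · exact fun c hc => (hclosed c hc).preimage hγc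
      · intro s hs
        obtain ⟨d, hd, h1, h2⟩ := hder γ hγ.hasDerivAt s hs
        exact ⟨d, hd, nonpos_of_mul_nonneg_right h1 hσ, fun hne => neg_of_mul_pos_right (h2 hne) hσ.le⟩
    · have := Function.Periodic.eq_zero_of_decreasing
        (f := fun s => tubeFunction φ g (γ (-s))) (p := T) (η := η) (t₀ := -t) hγ.pos
        (fun s => by
          have := hper.sub_eq (-s)
          simp only at this ⊢
          rw [neg_add', this]) (fun s => sq_nonneg _)
        (fun c hc => (hclosed c hc).preimage (hγc.comp continuous_neg)) (fun s hs => by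
          obtain ⟨d, hd, h1, h2⟩ := hder γ hγ.hasDerivAt (-s) hs
          refine ⟨-d, ?_, ?_, fun hne => ?_⟩
          · have h3 := hd.comp s (hasDerivAt_neg s)
            rw [mul_neg_one] at h3
            exact h3
          · exact neg_nonpos.2 (nonneg_of_mul_nonneg_right h1 hσ)
          · exact neg_neg_iff_pos.2 (pos_of_mul_pos_right (h2 hne) hσ.le))
        (by rwa [neg_neg])
      rwa [neg_neg] at this
  obtain ⟨Θ, T, hsol, -, -, -, -, hsurj⟩ := h.exists_isPeriodicSolution hφper hφ hmem'
  have hΓ : range (fun t => polarPoint (φ (Θ t)) (Θ t)) = range fun θ => polarPoint (φ θ) θ :=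
    hsurj.range_comp fun θ => polarPoint (φ θ) θ
  refine ⟨⟨_, T, hsol, hΓ⟩, {p | tubeFunction φ g p < η}, hopen, ?_, ?_⟩
  · rintro _ ⟨θ, rfl⟩
    have hr0 := h.radius_pos (hmem' θ)
    have : tubeFunction φ g (polarPoint (φ θ) θ) = 0 := by
      rw [tubeFunction_eq_zero_iff, radius_polarPoint hr0.le]
      refine hφper.eq_of_polarPoint_eq (r := φ θ) (r' := φ θ) hr0 hr0 ?_
      have := polarPoint_angleNear 0 (polarPoint (φ θ) θ)
      rw [radius_polarPoint hr0.le] at this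
      exact this.symm
    exact this.trans_lt hηpos
  · rintro _ ⟨γ, T', hγ, rfl⟩ ⟨_, ⟨t₀, rfl⟩, ht₀⟩
    have hγc : Continuous γ := continuous_iff_continuousAt.2 fun t => (hγ.hasDerivAt t).continuousAt
    -- On a periodic solution the open condition `< η` and the closed condition `≤ 0` coincide, so
    -- by connectedness of the time line one visit to the tube puts the whole orbit on the curve.
    have heq : γ ⁻¹' {p | tubeFunction φ g p < η} = γ ⁻¹' {p | tubeFunction φ g p ≤ 0} := by
      ext t
      exact ⟨fun ht => (htrap γ T' hγ t ht).le, fun ht => lt_of_le_of_lt ht hηpos⟩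
    have hclopen : IsClopen (γ ⁻¹' {p | tubeFunction φ g p < η}) :=
      ⟨heq ▸ (hclosed 0 hηpos).preimage hγc, hopen.preimage hγc⟩
    have huniv := hclopen.eq_univ ⟨t₀, ht₀⟩
    refine h.range_eq_of_subset hφper hmem' hγ.hasDerivAt fun t => ?_
    have ht : t ∈ γ ⁻¹' {p | tubeFunction φ g p < η} := huniv ▸ mem_univ t
    exact tubeFunction_eq_zero_iff.1 (htrap γ T' hγ t ht)

end IsAnnularField

/-! ### Floquet multipliers of planar periodic orbits. -/

theorem hasDerivAt_smulRight (l : ℝ × ℝ →L[ℝ] ℝ) {y : ℝ → ℝ × ℝ} {y' : ℝ × ℝ} {t : ℝ}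
    (hy : HasDerivAt y y' t) : HasDerivAt (fun t => l.smulRight (y t)) (l.smulRight y') t :=
  (ContinuousLinearMap.smulRightL ℝ (ℝ × ℝ) (ℝ × ℝ) l).hasFDerivAt.comp_hasDerivAt t hy

/-- The trace of an operator on `ℝ × ℝ`. -/
def planarTrace (A : ℝ × ℝ →L[ℝ] ℝ × ℝ) : ℝ := (A (1, 0)).1 + (A (0, 1)).2

theorem clm_apply_eq (A : ℝ × ℝ →L[ℝ] ℝ × ℝ) (w : ℝ × ℝ) :
    A w = ((A (1, 0)).1 * w.1 + (A (0, 1)).1 * w.2, (A (1, 0)).2 * w.1 + (A (0, 1)).2 * w.2) := by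
  have hw : w = w.1 • ((1, 0) : ℝ × ℝ) + w.2 • ((0, 1) : ℝ × ℝ) := by ext <;> simp
  conv_lhs => rw [hw, map_add, map_smul, map_smul]
  ext <;> simp [mul_comm]

theorem charpoly_eq_of_entries (M : ℝ × ℝ →ₗ[ℝ] ℝ × ℝ) :
    M.charpoly = Polynomial.X ^ 2 - Polynomial.C ((M (1, 0)).1 + (M (0, 1)).2) * Polynomial.X +
      Polynomial.C ((M (1, 0)).1 * (M (0, 1)).2 - (M (0, 1)).1 * (M (1, 0)).2) := by
  rw [← LinearMap.charpoly_toMatrix M (Module.Basis.finTwoProd ℝ), Matrix.charpoly_fin_two,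
    Matrix.trace_fin_two, Matrix.det_fin_two]
  simp [LinearMap.toMatrix_apply]

theorem countP_aroots_eq_one {μ : ℝ} (hμ0 : 0 < μ) (hμ1 : μ ≠ 1)
    [DecidablePred fun z : ℂ => ‖z‖ = 1] {p : Polynomial ℝ}
    (hp : p = (Polynomial.X - Polynomial.C 1) * (Polynomial.X - Polynomial.C μ)) :
    (p.aroots ℂ).countP (fun z => ‖z‖ = 1) = 1 := by
  have hne : (Polynomial.X - Polynomial.C (1 : ℝ)) * (Polynomial.X - Polynomial.C μ) ≠ 0 :=
    mul_ne_zero (Polynomial.X_sub_C_ne_zero _) (Polynomial.X_sub_C_ne_zero _)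
  have h : p.aroots ℂ = {1} + {(μ : ℂ)} := by
    rw [hp, Polynomial.aroots_mul hne, Polynomial.aroots_X_sub_C, Polynomial.aroots_X_sub_C]
    simp
  rw [h, Multiset.countP_add]
  have h1 : Multiset.countP (fun z : ℂ => ‖z‖ = 1) {1} = 1 := by
    rw [← Multiset.cons_zero, Multiset.countP_cons_of_pos _ (by simp), Multiset.countP_zero]
  have h2 : Multiset.countP (fun z : ℂ => ‖z‖ = 1) {(μ : ℂ)} = 0 := by
    rw [← Multiset.cons_zero, Multiset.countP_cons_of_neg, Multiset.countP_zero]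
    rwa [Complex.norm_real, norm_eq_abs, abs_of_pos hμ0]
  rw [h1, h2]

/-- A planar linear equation with a nonvanishing solution `y` has, by reduction of order, a second
solution `s y + β n`, where `n = J y / |y|²` and `β = exp ∫ tr`. -/
theorem exists_second_solution {A : ℝ → ℝ × ℝ →L[ℝ] ℝ × ℝ} (hA : Continuous A) {y : ℝ → ℝ × ℝ}
    (hy : ∀ t, HasDerivAt y (A t (y t)) t) (hne : ∀ t, y t ≠ 0) :
    ∃ s : ℝ → ℝ, s 0 = 0 ∧ ∀ t, HasDerivAt (fun t => s t • y t +
      exp (∫ τ in (0 : ℝ)..t, planarTrace (A τ)) •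
        ((-(y t).2 / ((y t).1 ^ 2 + (y t).2 ^ 2), (y t).1 / ((y t).1 ^ 2 + (y t).2 ^ 2)) : ℝ × ℝ))
      (A t (s t • y t + exp (∫ τ in (0 : ℝ)..t, planarTrace (A τ)) •
        ((-(y t).2 / ((y t).1 ^ 2 + (y t).2 ^ 2), (y t).1 / ((y t).1 ^ 2 + (y t).2 ^ 2)) : ℝ × ℝ)))
      t := by
  have hyc : Continuous y := continuous_iff_continuousAt.2 fun t => (hy t).continuousAt
  have hN : ∀ t, (y t).1 ^ 2 + (y t).2 ^ 2 ≠ 0 := fun t h0 => hne t (by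
    have h1 : (y t).1 ^ 2 = 0 := by nlinarith [sq_nonneg (y t).1, sq_nonneg (y t).2]
    have h2 : (y t).2 ^ 2 = 0 := by nlinarith [sq_nonneg (y t).1, sq_nonneg (y t).2]
    exact Prod.ext (pow_eq_zero_iff two_ne_zero |>.1 h1) (pow_eq_zero_iff two_ne_zero |>.1 h2))
  have hAw : ∀ w : ℝ × ℝ, Continuous fun t => A t w := fun w => hA.clm_apply continuous_const
  have htr : Continuous fun t => planarTrace (A t) :=
    (hAw (1, 0)).fst.add (hAw (0, 1)).snd
  let β : ℝ → ℝ := fun t => exp (∫ τ in (0 : ℝ)..t, planarTrace (A τ))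
  have hβ : ∀ t, HasDerivAt β (β t * planarTrace (A t)) t := fun t =>
    (htr.hasDerivAt_primitive 0 t).exp
  have hβc : Continuous β := continuous_iff_continuousAt.2 fun t => (hβ t).continuousAt
  -- The derivative that `s` must have: the component along `y` of `β (A n - n')`. The component
  -- along `J y` balances because `β' = β tr A`.
  let k : ℝ → ℝ := fun t => β t * (((y t).1 ^ 2 - (y t).2 ^ 2) * ((A t (0, 1)).1 + (A t (1, 0)).2) +
    2 * (y t).1 * (y t).2 * ((A t (0, 1)).2 - (A t (1, 0)).1)) / ((y t).1 ^ 2 + (y t).2 ^ 2) ^ 2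
  have hk : Continuous k := by
    refine Continuous.div (hβc.mul (Continuous.add ?_ ?_)) (by fun_prop) fun t => pow_ne_zero 2 (hN t)
    · exact ((hyc.fst.pow 2).sub (hyc.snd.pow 2)).mul ((hAw (0, 1)).fst.add (hAw (1, 0)).snd)
    · exact ((continuous_const.mul hyc.fst).mul hyc.snd).mul ((hAw (0, 1)).snd.sub (hAw (1, 0)).fst)
  let s : ℝ → ℝ := fun t => ∫ τ in (0 : ℝ)..t, k τ
  refine ⟨s, intervalIntegral.integral_same, fun t => ?_⟩
  have hs : HasDerivAt s (k t) t := hk.hasDerivAt_primitive 0 t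
  have h1 := (hy t).fst_coord
  have h2 := (hy t).snd_coord
  have hNd := (h1.pow 2).add (h2.pow 2)
  have hn := HasDerivAt.prodMk (h2.neg.div hNd (hN t)) (h1.div hNd (hN t))
  refine ((hs.smul (hy t)).add ((hβ t).smul hn)).congr_deriv ?_
  have hNt := hN t
  rw [map_add, map_smul, map_smul, clm_apply_eq (A t) (y t), clm_apply_eq (A t)
    (-(y t).2 / ((y t).1 ^ 2 + (y t).2 ^ 2), (y t).1 / ((y t).1 ^ 2 + (y t).2 ^ 2))]
  change _ = _ + β t • _
  have hsq : ((fun s => (y s).1) ^ 2 + (fun s => (y s).2) ^ 2) t = (y t).1 ^ 2 + (y t).2 ^ 2 := rfl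
  simp only [Pi.neg_apply, Pi.div_apply, hsq, k, planarTrace]
  generalize β t = b
  generalize s t = c
  generalize (A t (1, 0)).1 = a₁₁
  generalize (A t (1, 0)).2 = a₂₁
  generalize (A t (0, 1)).1 = a₁₂
  generalize (A t (0, 1)).2 = a₂₂
  generalize y t = w at *
  obtain ⟨p, q⟩ := w
  simp only at hNt
  refine Prod.ext ?_ ?_ <;>
    simp only [Prod.fst_add, Prod.snd_add, Prod.smul_fst, Prod.smul_snd, smul_eq_mul, Nat.cast_ofNat]
  · field_simp
    ring
  · field_simp
    ring

/-- A periodic orbit of a `C¹` planar field is hyperbolic if the divergence has nonzero integral along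
it. -/
theorem isHyperbolicOrbit_of_integral_ne_zero {v : ℝ × ℝ → ℝ × ℝ} (hv : ContDiff ℝ 1 v)
    {γ : ℝ → ℝ × ℝ} {T : ℝ} (hγ : IsPeriodicSolution v γ T) (hne : ∀ t, v (γ t) ≠ 0)
    (hdiv : ∫ t in (0 : ℝ)..T, planarTrace (fderiv ℝ v (γ t)) ≠ 0) :
    IsHyperbolicOrbit v (range γ) := by
  have hγc : Continuous γ := continuous_iff_continuousAt.2 fun t => (hγ.hasDerivAt t).continuousAt
  have hA : Continuous fun t => fderiv ℝ v (γ t) := (hv.continuous_fderiv one_ne_zero).comp hγc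
  have hy : ∀ t, HasDerivAt (fun t => v (γ t)) (fderiv ℝ v (γ t) (v (γ t))) t := fun t =>
    ((hv.differentiable one_ne_zero) (γ t)).hasFDerivAt.comp_hasDerivAt t (hγ.hasDerivAt t)
  obtain ⟨s, hs0, hs⟩ := exists_second_solution hA hy hne
  have hγT : γ T = γ 0 := by simpa using hγ.periodic 0
  generalize hp : (v (γ 0)).1 = p
  generalize hq : (v (γ 0)).2 = q
  have hv0 : v (γ 0) = (p, q) := Prod.ext hp hq
  have hN : p ^ 2 + q ^ 2 ≠ 0 := fun h0 => hne 0 (by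
    have h1 : p ^ 2 = 0 := by nlinarith [sq_nonneg p, sq_nonneg q]
    have h2 : q ^ 2 = 0 := by nlinarith [sq_nonneg p, sq_nonneg q]
    rw [hv0, (pow_eq_zero_iff two_ne_zero).1 h1, (pow_eq_zero_iff two_ne_zero).1 h2]; rfl)
  -- `l₁, l₂` is the basis dual to `v (γ 0)` and its normal `n`. In that basis the monodromy is
  -- triangular with diagonal `1, μ`, the field along the orbit being a periodic solution of the
  -- variational equation.
  let l₁ : ℝ × ℝ →L[ℝ] ℝ := (p / (p ^ 2 + q ^ 2)) • ContinuousLinearMap.fst ℝ ℝ ℝ +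
    (q / (p ^ 2 + q ^ 2)) • ContinuousLinearMap.snd ℝ ℝ ℝ
  let l₂ : ℝ × ℝ →L[ℝ] ℝ := p • ContinuousLinearMap.snd ℝ ℝ ℝ - q • ContinuousLinearMap.fst ℝ ℝ ℝ
  let y₂ : ℝ → ℝ × ℝ := fun t => s t • v (γ t) +
      exp (∫ τ in (0 : ℝ)..t, planarTrace (fderiv ℝ v (γ τ))) •
        ((-(v (γ t)).2 / ((v (γ t)).1 ^ 2 + (v (γ t)).2 ^ 2),
          (v (γ t)).1 / ((v (γ t)).1 ^ 2 + (v (γ t)).2 ^ 2)) : ℝ × ℝ)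
  set μ : ℝ := exp (∫ τ in (0 : ℝ)..T, planarTrace (fderiv ℝ v (γ τ))) with hμ
  have hy₂T : y₂ T = (s T * p - μ * q / (p ^ 2 + q ^ 2), s T * q + μ * p / (p ^ 2 + q ^ 2)) := by
    simp only [y₂, hγT, hv0, ← hμ]
    refine Prod.ext ?_ ?_ <;> simp <;> ring
  have hy₂0 : y₂ 0 = (-q / (p ^ 2 + q ^ 2), p / (p ^ 2 + q ^ 2)) := by
    simp only [y₂, hv0, hs0, intervalIntegral.integral_same, exp_zero, zero_smul, one_smul, zero_add]
  refine ⟨γ, T, l₁.smulRight (v (γ T)) + l₂.smulRight (y₂ T), hγ, rfl,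
    ⟨fun t => l₁.smulRight (v (γ t)) + l₂.smulRight (y₂ t), ?_, fun t => ?_, rfl⟩, ?_⟩
  · refine ContinuousLinearMap.ext fun w => ?_
    simp only [hv0, hy₂0]
    refine Prod.ext ?_ ?_ <;> simp [l₁, l₂] <;> field_simp <;> ring
  · refine ((hasDerivAt_smulRight l₁ (hy t)).add (hasDerivAt_smulRight l₂ (hs t))).congr_deriv ?_
    refine ContinuousLinearMap.ext fun w => ?_
    simp only [add_apply, ContinuousLinearMap.smulRight_apply,
      ContinuousLinearMap.comp_apply, map_add, map_smul, y₂]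
  · refine countP_aroots_eq_one (exp_pos _) (fun h => hdiv (exp_eq_one_iff _ |>.1 h)) ?_
    rw [charpoly_eq_of_entries, ← hμ]
    have htr : ∀ a b : ℝ, a = 1 + μ → b = μ →
        Polynomial.X ^ 2 - Polynomial.C a * Polynomial.X + Polynomial.C b =
          (Polynomial.X - Polynomial.C 1) * (Polynomial.X - Polynomial.C μ) := by
      rintro _ _ rfl rfl
      rw [map_add, map_one]
      ring
    simp only [hγT, hv0, hy₂T]
    refine htr _ _ ?_ ?_ <;> simp [l₁, l₂] <;> field_simp <;> ring

/-! ### Uniform estimates in the angle and averages of the divergence. -/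

theorem IsCompact.eventually_forall_abs_sub_lt {Y Z : Type*} [TopologicalSpace Y]
    [TopologicalSpace Z] {K : Set Y} (hK : IsCompact K) {f : Z → Y → ℝ} {k : Y → ℝ} {x₀ : Z}
    (hf : ∀ y ∈ K, ContinuousAt (fun z : Z × Y => f z.1 z.2) (x₀, y)) (hk : Continuous k)
    (h0 : ∀ y, f x₀ y = k y) {e : ℝ} (he : 0 < e) :
    ∀ᶠ x in 𝓝 x₀, ∀ y ∈ K, |f x y - k y| < e := by
  refine hK.eventually_forall_of_forall_eventually fun y hy => ?_
  have h1 : ContinuousAt (fun z : Z × Y => |f z.1 z.2 - k z.2|) (x₀, y) :=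
    ((hf y hy).sub (hk.continuousAt.comp continuousAt_snd)).abs
  refine h1.eventually (gt_mem_nhds ?_)
  simp only [h0, sub_self, abs_zero, he]

theorem Function.Periodic.forall_of_forall_Icc {p : ℝ} (hp : 0 < p) {Pr : ℝ → Prop}
    (hper : Function.Periodic Pr p) (h : ∀ θ ∈ Icc 0 p, Pr θ) (θ : ℝ) : Pr θ := by
  obtain ⟨y, hy, hy'⟩ := hper.exists_mem_Ico₀ hp θ
  rw [hy']
  exact h y (Ico_subset_Icc_self hy)

theorem Function.Periodic.periodic_primitive {f : ℝ → ℝ} {p : ℝ} (hper : Function.Periodic f p)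
    (hf : Continuous f) (h0 : ∫ θ in (0 : ℝ)..p, f θ = 0) :
    Function.Periodic (fun θ => ∫ s in (0 : ℝ)..θ, f s) p := fun θ => by
  have h2 := hper.intervalIntegral_add_eq θ 0
  rw [zero_add, h0] at h2
  have := intervalIntegral.integral_add_adjacent_intervals (hf.intervalIntegrable 0 θ)
    (hf.intervalIntegrable (μ := MeasureTheory.volume) θ (θ + p))
  simp only
  rw [← this, h2, add_zero]

/-- Time averages along a curve close to the circle of radius `ρ`, run through at almost unit angular
speed, are close to the average over the circle. -/
theorem exists_integral_ne_zero_of_near_circle {h : ℝ × ℝ → ℝ} (hc : Continuous h) {ρ : ℝ}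
    (hI : ∫ θ in (0 : ℝ)..(2 * π), h (polarPoint ρ θ) ≠ 0) :
    ∃ s > 0, ∀ (φ Θ w : ℝ → ℝ) (T : ℝ), Continuous φ → (∀ θ, |φ θ - ρ| < s) → 0 < T → Θ 0 = 0 →
      Θ T = 2 * π → (∀ t, HasDerivAt Θ (w t) t) → Continuous w → (∀ t, |w t - 1| ≤ s) →
      ∫ t in (0 : ℝ)..T, h (polarPoint (φ (Θ t)) (Θ t)) ≠ 0 := by
  set c := ∫ θ in (0 : ℝ)..(2 * π), h (polarPoint ρ θ) with hcdef
  have hπ := pi_pos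
  have hcpos : 0 < |c| := abs_pos.2 hI
  -- The integrand will be off by at most `2 * κ` and `T ≤ 4 * π`, so the total error is at most
  -- `|c| / 2`.
  set κ := |c| / (16 * π) with hκ
  have hκpos : 0 < κ := by positivity
  have hpp : Continuous fun z : ℝ × ℝ => polarPoint z.1 z.2 := by unfold polarPoint; fun_prop
  have hk : Continuous fun θ => h (polarPoint ρ θ) :=
    hc.comp (continuous_polarPoint continuous_const continuous_id)
  have hpolper : ∀ r, Function.Periodic (fun θ => polarPoint r θ) (2 * π) := fun r θ => by
    simp [polarPoint]
  have hkper : Function.Periodic (fun θ => h (polarPoint ρ θ)) (2 * π) := fun θ => by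
    simp only [hpolper ρ θ]
  obtain ⟨B, hB⟩ := hkper.exists_abs_le two_pi_pos hk
  have hB0 : 0 ≤ B := (abs_nonneg _).trans (hB 0)
  obtain ⟨d, hd, hd'⟩ := Metric.eventually_nhds_iff.1 (isCompact_Icc (a := (0 : ℝ)) (b := 2 * π)
    |>.eventually_forall_abs_sub_lt (f := fun r θ => h (polarPoint r θ)) (x₀ := ρ)
    (fun θ _ => (hc.comp hpp).continuousAt) hk (fun _ => rfl) hκpos)
  have hnear : ∀ r, |r - ρ| < d → ∀ θ, |h (polarPoint r θ) - h (polarPoint ρ θ)| < κ := by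
    intro r hr
    refine Function.Periodic.forall_of_forall_Icc two_pi_pos (fun θ => ?_) (hd' hr)
    simp only [hpolper r θ, hpolper ρ θ]
  refine ⟨min d (min (1 / 2) (κ / (B + 1))), by positivity, ?_⟩
  intro φ Θ w T hφ hφρ hT hΘ0 hΘT hΘ hw hw1
  have hΘc : Continuous Θ := continuous_iff_continuousAt.2 fun t => (hΘ t).continuousAt
  have hw2 : ∀ t, |w t - 1| ≤ 1 / 2 := fun t =>
    (hw1 t).trans ((min_le_right _ _).trans (min_le_left _ _))
  have hw3 : ∀ t, |w t - 1| ≤ κ / (B + 1) := fun t =>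
    (hw1 t).trans ((min_le_right _ _).trans (min_le_right _ _))
  have hT4 : T ≤ 4 * π := by
    have h1 : ∫ t in (0 : ℝ)..T, w t = Θ T - Θ 0 :=
      intervalIntegral.integral_eq_sub_of_hasDerivAt (fun t _ => hΘ t) (hw.intervalIntegrable _ _)
    have h2 : ∫ t in (0 : ℝ)..T, (1 / 2 : ℝ) ≤ ∫ t in (0 : ℝ)..T, w t :=
      intervalIntegral.integral_mono_on hT.le intervalIntegrable_const (hw.intervalIntegrable _ _)
        fun t _ => by linarith [(abs_le.1 (hw2 t)).1]
    rw [intervalIntegral.integral_const, h1, hΘ0, hΘT, smul_eq_mul] at h2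
    linarith
  have hsub : ∫ t in (0 : ℝ)..T, h (polarPoint ρ (Θ t)) * w t = c := by
    have := intervalIntegral.integral_comp_mul_deriv (a := 0) (b := T) (f := Θ) (f' := w)
      (g := fun θ => h (polarPoint ρ θ)) (fun t _ => hΘ t) hw.continuousOn hk
    simp only [Function.comp_apply] at this
    rw [this, hΘ0, hΘT]
  have hc1 : Continuous fun t => h (polarPoint (φ (Θ t)) (Θ t)) :=
    hc.comp (continuous_polarPoint (hφ.comp hΘc) hΘc)
  have hc2 : Continuous fun t => h (polarPoint ρ (Θ t)) * w t := (hk.comp hΘc).mul hw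
  have hbound : ∀ t, |h (polarPoint (φ (Θ t)) (Θ t)) - h (polarPoint ρ (Θ t)) * w t| ≤ 2 * κ := by
    intro t
    have h1 := (hnear (φ (Θ t)) ((hφρ (Θ t)).trans_le (min_le_left _ _)) (Θ t)).le
    have h2 : |h (polarPoint ρ (Θ t)) * (w t - 1)| ≤ κ := by
      rw [abs_mul]
      calc _ ≤ (B + 1) * (κ / (B + 1)) :=
            mul_le_mul ((hB _).trans (by linarith)) (hw3 t) (abs_nonneg _) (by linarith)
        _ = κ := by field_simp
    calc _ = |(h (polarPoint (φ (Θ t)) (Θ t)) - h (polarPoint ρ (Θ t))) -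
          h (polarPoint ρ (Θ t)) * (w t - 1)| := by congr 1; ring
      _ ≤ _ := (abs_sub _ _).trans (by linarith)
  have hdiff := intervalIntegral.norm_integral_le_of_norm_le_const (a := 0) (b := T)
    (f := fun t => h (polarPoint (φ (Θ t)) (Θ t)) - h (polarPoint ρ (Θ t)) * w t)
    (C := 2 * κ) fun t _ => hbound t
  rw [intervalIntegral.integral_sub (hc1.intervalIntegrable _ _) (hc2.intervalIntegrable _ _), hsub,
    sub_zero, abs_of_pos hT, norm_eq_abs] at hdiff
  intro h0
  rw [h0, zero_sub, abs_neg] at hdiff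
  have h3 : 2 * κ * T ≤ 2 * κ * (4 * π) := mul_le_mul_of_nonneg_left hT4 (by positivity)
  have h4 : 2 * κ * (4 * π) = |c| / 2 := by rw [hκ]; field_simp; norm_num
  linarith

/-- For a homogeneous differentiable field, the integral of the divergence over a circle centred at
the origin. -/
theorem integral_divergence_circle {X : ℝ × ℝ → ℝ × ℝ} {α : ℝ} (hX : ContDiff ℝ 1 X)
    (hhom : IsHomogeneousField X α) {ρ : ℝ} (hρ : 0 < ρ) :
    ∫ θ in (0 : ℝ)..(2 * π), planarTrace (fderiv ℝ X (polarPoint ρ θ)) =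
      (α + 1) * ρ ^ (α - 1) * radialIntegral X := by
  have hpol : ∀ r, 0 ≤ r → ∀ θ, X (polarPoint r θ) = r ^ α • X (cos θ, sin θ) := fun r hr θ =>
    hhom.2 (cos θ, sin θ) r hr
  let F : ℝ → ℝ := fun θ => (X (cos θ, sin θ)).1 * cos θ + (X (cos θ, sin θ)).2 * sin θ
  let H : ℝ → ℝ := fun θ => (X (polarPoint ρ θ)).2 * cos θ - (X (polarPoint ρ θ)).1 * sin θ
  have hcirc : Continuous fun θ : ℝ => (cos θ, sin θ) := continuous_cos.prodMk continuous_sin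
  have hXc : Continuous fun θ : ℝ => X (cos θ, sin θ) := hX.continuous.comp hcirc
  have hF : Continuous F := (hXc.fst.mul continuous_cos).add (hXc.snd.mul continuous_sin)
  have hA : Continuous fun θ : ℝ => fderiv ℝ X (polarPoint ρ θ) :=
    (hX.continuous_fderiv one_ne_zero).comp (continuous_polarPoint continuous_const continuous_id)
  have htr : Continuous fun θ => planarTrace (fderiv ℝ X (polarPoint ρ θ)) :=
    (hA.clm_apply continuous_const).fst.add (hA.clm_apply continuous_const).snd
  -- The polar formula `r div X = ∂_r (r X_r) + ∂_θ X_θ`, with `X_r = r ^ α F`. Euler's relation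
  -- supplies the radial derivative, and the `∂_θ` term integrates to zero over a period.
  have hH : ∀ θ, HasDerivAt H
      (ρ * planarTrace (fderiv ℝ X (polarPoint ρ θ)) - (α + 1) * ρ ^ α * F θ) θ := by
    intro θ
    have hD := ((hX.differentiable one_ne_zero) (polarPoint ρ θ)).hasFDerivAt
    have hr : HasDerivAt (fun r => polarPoint r θ) (cos θ, sin θ) ρ := by
      have := hasDerivAt_polarPoint (t := ρ) (hasDerivAt_id ρ) (hasDerivAt_const ρ θ)
      simpa using this
    have hθ : HasDerivAt (fun θ => polarPoint ρ θ) (-(ρ * sin θ), ρ * cos θ) θ := by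
      have := hasDerivAt_polarPoint (t := θ) (hasDerivAt_const θ ρ) (hasDerivAt_id θ)
      simpa using this
    have h1 := hD.comp_hasDerivAt ρ hr
    have h2 : HasDerivAt (fun r : ℝ => r ^ α • X (cos θ, sin θ))
        ((α * ρ ^ (α - 1)) • X (cos θ, sin θ)) ρ :=
      (hasDerivAt_rpow_const (Or.inl hρ.ne')).smul_const _
    have heuler := h1.unique (h2.congr_of_eventuallyEq (by
      filter_upwards [lt_mem_nhds hρ] with r hr
      exact hpol r hr.le θ))
    have h3 := hD.comp_hasDerivAt θ hθ
    refine ((h3.snd_coord.mul (hasDerivAt_cos θ)).sub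
      (h3.fst_coord.mul (hasDerivAt_sin θ))).congr_deriv ?_
    have hpow : ρ ^ α = ρ ^ (α - 1) * ρ := by rw [← rpow_add_one hρ.ne', sub_add_cancel]
    simp only [Function.comp_apply, hpol ρ hρ.le θ, F, planarTrace, hpow]
    rw [clm_apply_eq] at heuler ⊢
    have e1 := congrArg Prod.fst heuler
    have e2 := congrArg Prod.snd heuler
    simp only [Prod.smul_fst, Prod.smul_snd, smul_eq_mul] at e1 e2 ⊢
    have hcs := cos_sq_add_sin_sq θ
    linear_combination (-(ρ * cos θ)) * e1 - ρ * sin θ * e2 +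
      ρ * ((fderiv ℝ X (polarPoint ρ θ) (1, 0)).1 + (fderiv ℝ X (polarPoint ρ θ) (0, 1)).2) * hcs
  have hint := intervalIntegral.integral_eq_sub_of_hasDerivAt (a := 0) (b := 2 * π)
    (fun θ _ => hH θ) (((htr.const_mul ρ).sub (hF.const_mul _)).intervalIntegrable _ _)
  have hend : H (2 * π) - H 0 = 0 := by simp [H, polarPoint]
  rw [hend, intervalIntegral.integral_sub ((htr.const_mul ρ).intervalIntegrable _ _)
    ((hF.const_mul _).intervalIntegrable _ _), intervalIntegral.integral_const_mul,
    intervalIntegral.integral_const_mul] at hint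
  have hrad : ∫ θ in (0 : ℝ)..(2 * π), F θ = radialIntegral X := rfl
  have hpow : ρ ^ α = ρ ^ (α - 1) * ρ := by rw [← rpow_add_one hρ.ne', sub_add_cancel]
  rw [hrad, hpow] at hint
  refine mul_left_cancel₀ hρ.ne' ?_
  linear_combination hint

/-! ### First order averaging. -/

/-- `2π`-periodic functions of `(r, θ)`, `r > 0`, with continuous partial derivatives in `r`; they
define the polar equations `ṙ = ε S`, `θ̇ = 1 + ε G`. -/
structure IsAveragingData (S S' G G' : ℝ → ℝ → ℝ) : Prop where
  deriv_S : ∀ r, 0 < r → ∀ θ, HasDerivAt (fun r => S r θ) (S' r θ) r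
  deriv_G : ∀ r, 0 < r → ∀ θ, HasDerivAt (fun r => G r θ) (G' r θ) r
  cont_S : ∀ r, 0 < r → ∀ θ, ContinuousAt (fun z : ℝ × ℝ => S z.1 z.2) (r, θ)
  cont_S' : ∀ r, 0 < r → ∀ θ, ContinuousAt (fun z : ℝ × ℝ => S' z.1 z.2) (r, θ)
  cont_G : ∀ r, 0 < r → ∀ θ, ContinuousAt (fun z : ℝ × ℝ => G z.1 z.2) (r, θ)
  cont_G' : ∀ r, 0 < r → ∀ θ, ContinuousAt (fun z : ℝ × ℝ => G' z.1 z.2) (r, θ)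
  per_S : ∀ r, Function.Periodic (S r) (2 * π)
  per_S' : ∀ r, Function.Periodic (S' r) (2 * π)
  per_G : ∀ r, Function.Periodic (G r) (2 * π)
  per_G' : ∀ r, Function.Periodic (G' r) (2 * π)

namespace IsAveragingData

variable {S S' G G' : ℝ → ℝ → ℝ} (h : IsAveragingData S S' G G')
include h

theorem continuous_S {r : ℝ} (hr : 0 < r) : Continuous (S r) :=
  continuous_iff_continuousAt.2 fun θ => ContinuousAt.comp
    (g := fun z : ℝ × ℝ => S z.1 z.2) (f := fun θ => (r, θ)) (h.cont_S r hr θ) (by fun_prop)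

theorem continuous_S' {r : ℝ} (hr : 0 < r) : Continuous (S' r) :=
  continuous_iff_continuousAt.2 fun θ => ContinuousAt.comp
    (g := fun z : ℝ × ℝ => S' z.1 z.2) (f := fun θ => (r, θ)) (h.cont_S' r hr θ) (by fun_prop)

theorem continuous_G {r : ℝ} (hr : 0 < r) : Continuous (G r) :=
  continuous_iff_continuousAt.2 fun θ => ContinuousAt.comp
    (g := fun z : ℝ × ℝ => G z.1 z.2) (f := fun θ => (r, θ)) (h.cont_G r hr θ) (by fun_prop)

/-- Uniform estimates for `S / (1 + ε G)` near the circle of radius `ρ` and `ε = 0`. -/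
theorem exists_uniform_estimates {ρ κ s : ℝ} (hρ : 0 < ρ) (hκ : 0 < κ) (hs : 0 < s) :
    ∃ d > 0, d < ρ ∧ d ≤ s ∧ ∃ L, ∀ ε, |ε| < d → ∀ θ, ∀ r ∈ Icc (ρ - d) (ρ + d),
      |ε * G r θ| ≤ s ∧ |ε * G r θ| ≤ 1 / 2 ∧ |S r θ / (1 + ε * G r θ)| ≤ L ∧
      ∀ r' ∈ Icc (ρ - d) (ρ + d), |S r θ / (1 + ε * G r θ) - S r' θ / (1 + ε * G r' θ) -
        (r - r') * S' ρ θ| ≤ κ * |r - r'| := by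
  have hSc := h.continuous_S hρ
  obtain ⟨B, hB⟩ := (h.per_S ρ).exists_abs_le two_pi_pos hSc
  have lift : ∀ (A : ℝ → ℝ → ℝ), (∀ θ, ContinuousAt (fun z : ℝ × ℝ => A z.1 z.2) (ρ, θ)) → ∀ θ,
      ContinuousAt (fun z : (ℝ × ℝ) × ℝ => A z.1.2 z.2) ((0, ρ), θ) := fun A hA θ =>
    ContinuousAt.comp (g := fun z : ℝ × ℝ => A z.1 z.2)
      (f := fun z : (ℝ × ℝ) × ℝ => (z.1.2, z.2)) (hA θ) (by fun_prop)
  have cS := lift S (h.cont_S ρ hρ)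
  have cS' := lift S' (h.cont_S' ρ hρ)
  have cG := lift G (h.cont_G ρ hρ)
  have cG' := lift G' (h.cont_G' ρ hρ)
  have cε : ∀ θ, ContinuousAt (fun z : (ℝ × ℝ) × ℝ => z.1.1) ((0, ρ), θ) := fun θ => by fun_prop
  have cD : ∀ θ, ContinuousAt (fun z : (ℝ × ℝ) × ℝ => 1 + z.1.1 * G z.1.2 z.2) ((0, ρ), θ) :=
    fun θ => continuousAt_const.add ((cε θ).mul (cG θ))
  have hK := isCompact_Icc (a := (0 : ℝ)) (b := 2 * π)
  -- `ev1`, `ev2`, `ev3` control `ε G`, the quotient and its `r`-derivative near `(ε, r) = (0, ρ)`,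
  -- where they equal `0`, `S` and `S'`.
  have ev1 := hK.eventually_forall_abs_sub_lt (x₀ := ((0, ρ) : ℝ × ℝ))
    (f := fun x θ => x.1 * G x.2 θ) (k := fun _ => 0) (fun θ _ => (cε θ).mul (cG θ))
    continuous_const (fun θ => zero_mul _) (lt_min hs one_half_pos)
  have ev2 := hK.eventually_forall_abs_sub_lt (x₀ := ((0, ρ) : ℝ × ℝ))
    (f := fun x θ => S x.2 θ / (1 + x.1 * G x.2 θ)) (k := S ρ)
    (fun θ _ => (cS θ).div (cD θ) (by simp)) hSc (fun θ => by simp) one_pos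
  have ev3 := hK.eventually_forall_abs_sub_lt (x₀ := ((0, ρ) : ℝ × ℝ))
    (f := fun x θ => (S' x.2 θ * (1 + x.1 * G x.2 θ) - S x.2 θ * (x.1 * G' x.2 θ)) /
      (1 + x.1 * G x.2 θ) ^ 2) (k := S' ρ)
    (fun θ _ => (((cS' θ).mul (cD θ)).sub ((cS θ).mul ((cε θ).mul (cG' θ)))).div ((cD θ).pow 2)
      (by simp)) (h.continuous_S' hρ) (fun θ => by simp) hκ
  obtain ⟨d₀, hd₀, hd⟩ := Metric.eventually_nhds_iff.1 (ev1.and (ev2.and ev3))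
  have hdpos : 0 < min (d₀ / 2) (min (ρ / 2) s) := by positivity
  refine ⟨min (d₀ / 2) (min (ρ / 2) s), hdpos,
    ((min_le_right _ _).trans (min_le_left _ _)).trans_lt (by linarith),
    (min_le_right _ _).trans (min_le_right _ _), B + 1, fun ε hε θ => ?_⟩
  generalize hmin : min (d₀ / 2) (min (ρ / 2) s) = d at *
  have hdd : d ≤ d₀ / 2 := hmin ▸ min_le_left _ _
  have hdρ : d ≤ ρ / 2 := hmin ▸ (min_le_right _ _).trans (min_le_left _ _)
  have key : ∀ r ∈ Icc (ρ - d) (ρ + d), |ε * G r θ| < min s (1 / 2) ∧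
      |S r θ / (1 + ε * G r θ) - S ρ θ| < 1 ∧
      |(S' r θ * (1 + ε * G r θ) - S r θ * (ε * G' r θ)) / (1 + ε * G r θ) ^ 2 - S' ρ θ| < κ := by
    intro r hr
    have hdist : dist ((ε, r) : ℝ × ℝ) (0, ρ) < d₀ := by
      rw [Prod.dist_eq, max_lt_iff, Real.dist_eq, Real.dist_eq, sub_zero]
      exact ⟨by linarith, by rw [abs_lt]; constructor <;> linarith [hr.1, hr.2]⟩
    obtain ⟨h1, h2, h3⟩ := hd hdist
    refine Function.Periodic.forall_of_forall_Icc (Pr := fun θ => |ε * G r θ| < min s (1 / 2) ∧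
      |S r θ / (1 + ε * G r θ) - S ρ θ| < 1 ∧
      |(S' r θ * (1 + ε * G r θ) - S r θ * (ε * G' r θ)) / (1 + ε * G r θ) ^ 2 - S' ρ θ| < κ)
      two_pi_pos (fun θ => ?_) (fun θ hθ => ⟨by simpa using h1 θ hθ, h2 θ hθ, h3 θ hθ⟩) θ
    simp only [h.per_S r θ, h.per_S' r θ, h.per_G r θ, h.per_G' r θ, h.per_S ρ θ, h.per_S' ρ θ]
  have hden : ∀ r ∈ Icc (ρ - d) (ρ + d), 1 + ε * G r θ ≠ 0 := fun r hr => by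
    have h1 := abs_lt.1 ((key r hr).1.trans_le (min_le_right _ _))
    linarith [h1.1]
  intro r hr
  obtain ⟨h1, h2, h3⟩ := key r hr
  refine ⟨(h1.trans_le (min_le_left _ _)).le, (h1.trans_le (min_le_right _ _)).le, ?_,
    fun r' hr' => ?_⟩
  · have := abs_sub_abs_le_abs_sub (S r θ / (1 + ε * G r θ)) (S ρ θ)
    linarith [hB θ]
  · have hder : ∀ x ∈ Icc (ρ - d) (ρ + d), HasDerivWithinAt
        (fun x => S x θ / (1 + ε * G x θ) - x * S' ρ θ)
        ((S' x θ * (1 + ε * G x θ) - S x θ * (ε * G' x θ)) / (1 + ε * G x θ) ^ 2 - 1 * S' ρ θ)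
        (Icc (ρ - d) (ρ + d)) x := fun x hx => by
      have hx0 : 0 < x := by linarith [hx.1]
      exact (((h.deriv_S x hx0 θ).div (((h.deriv_G x hx0 θ).const_mul ε).const_add 1)
        (hden x hx)).sub ((hasDerivAt_id x).mul_const _)).hasDerivWithinAt
    have := (convex_Icc (ρ - d) (ρ + d)).norm_image_sub_le_of_norm_hasDerivWithin_le (C := κ) hder
      (fun x hx => by rw [one_mul]; exact (key x hx).2.2.le) hr' hr
    simp only [norm_eq_abs] at this
    refine le_of_eq_of_le ?_ this
    congr 1; ring

/-- Here the radius is fixed at `ρ`, so the tolerance may be chosen after the width of the annulus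
and may be small compared with it. -/
theorem eventually_near_average {ρ e : ℝ} (hρ : 0 < ρ) (he : 0 < e) :
    ∀ᶠ ε in 𝓝 (0 : ℝ), ∀ θ, |S ρ θ / (1 + ε * G ρ θ) - S ρ θ| < e := by
  have ev := (isCompact_Icc (a := (0 : ℝ)) (b := 2 * π)).eventually_forall_abs_sub_lt
    (x₀ := (0 : ℝ)) (f := fun ε θ => S ρ θ / (1 + ε * G ρ θ)) (k := S ρ) (fun θ _ => by
      have c1 := ((h.continuous_S hρ).comp continuous_snd).continuousAt (x := ((0 : ℝ), θ))
      have c2 := ((h.continuous_G hρ).comp continuous_snd).continuousAt (x := ((0 : ℝ), θ))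
      exact c1.div (continuousAt_const.add (continuousAt_fst.mul c2)) (by simp))
    (h.continuous_S hρ) (fun θ => by simp) he
  filter_upwards [ev] with ε hε
  refine Function.Periodic.forall_of_forall_Icc two_pi_pos (fun θ => ?_) hε
  simp only [h.per_S ρ θ, h.per_G ρ θ]

/-- First order averaging: a simple zero `ρ` of the averaged function gives a limit cycle near the
circle of radius `ρ` for all small `ε > 0`. -/
theorem eventually_exists_limitCycle {ρ s : ℝ} (hρ : 0 < ρ)
    (h0 : ∫ θ in (0 : ℝ)..(2 * π), S ρ θ = 0) (h1 : ∫ θ in (0 : ℝ)..(2 * π), S' ρ θ ≠ 0)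
    {v : ℝ → ℝ × ℝ → ℝ × ℝ} (hv : ∀ ε, Continuous (v ε))
    (hpol : ∀ ε r, 0 < r → ∀ θ, v ε (polarPoint r θ) =
      (ε * S r θ * cos θ - r * (1 + ε * G r θ) * sin θ,
        ε * S r θ * sin θ + r * (1 + ε * G r θ) * cos θ)) (hs : 0 < s) :
    ∀ᶠ ε in 𝓝[>] (0 : ℝ), ∃ (φ : ℝ → ℝ) (δ : ℝ), δ ≤ s ∧ Function.Periodic φ (2 * π) ∧
      IsAnnularField (v ε) (fun r θ => ε * S r θ) (fun r θ => 1 + ε * G r θ) ρ δ ∧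
      (∀ θ, HasDerivAt φ (ε * S (φ θ) θ / (1 + ε * G (φ θ) θ)) θ) ∧
      (∀ θ, φ θ ∈ Icc (ρ - δ / 2) (ρ + δ / 2)) ∧ (∀ θ, |ε * G (φ θ) θ| ≤ s) ∧
      IsLimitCycle (v ε) (range fun θ => polarPoint (φ θ) θ) := by
  set c := ∫ θ in (0 : ℝ)..(2 * π), S' ρ θ with hc
  have hπ := pi_pos
  have hcpos : 0 < |c| := abs_pos.2 h1
  set κ := |c| / (16 * π) with hκ
  have hκpos : 0 < κ := by positivity
  have hκc : κ * (16 * π) = |c| := by rw [hκ]; field_simp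
  have hS'c := h.continuous_S' hρ
  have hSc := h.continuous_S hρ
  obtain ⟨D, hD⟩ := (h.per_S' ρ).exists_abs_le two_pi_pos hS'c
  have hD0 : 0 ≤ D := (abs_nonneg _).trans (hD 0)
  obtain ⟨δ, hδ, hδρ, hδs, L, hest⟩ := h.exists_uniform_estimates hρ hκpos hs
  have hρmem : ρ ∈ Icc (ρ - δ) (ρ + δ) := ⟨by linarith, by linarith⟩
  have hL0 : 0 ≤ L := (abs_nonneg _).trans (hest 0 (by simpa using hδ) 0 ρ hρmem).2.2.1
  have hlin : ∀ (M e : ℝ), 0 < e → ∀ᶠ ε in 𝓝 (0 : ℝ), ε * M < e := fun M e he => by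
    have : ContinuousAt (fun ε : ℝ => ε * M) 0 := by fun_prop
    exact this.eventually (gt_mem_nhds (by simpa using he))
  have hsmall : ∀ᶠ ε in 𝓝 (0 : ℝ), |ε| < δ := by
    have : ContinuousAt (fun ε : ℝ => |ε|) 0 := continuous_abs.continuousAt
    exact this.eventually (gt_mem_nhds (by simpa using hδ))
  filter_upwards [self_mem_nhdsWithin, nhdsWithin_le_nhds hsmall,
    nhdsWithin_le_nhds (h.eventually_near_average hρ (show 0 < κ * (δ / 2) by positivity)),
    nhdsWithin_le_nhds (hlin (L * (2 * π)) (δ / 2 / 2) (by positivity)),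
    nhdsWithin_le_nhds (hlin (L * (2 * π) * D) (κ * (δ / 2)) (by positivity))]
    with ε hε hεδ hav hL1 hL2
  have hε0 : 0 < ε := hε
  have hest := hest ε hεδ
  have hsub : ∀ r ∈ Icc (ρ - δ / 2) (ρ + δ / 2), r ∈ Icc (ρ - δ) (ρ + δ) := fun r hr =>
    ⟨by linarith [hr.1], by linarith [hr.2]⟩
  have hdiv : ∀ r θ, ε * S r θ / (1 + ε * G r θ) = ε * (S r θ / (1 + ε * G r θ)) := fun r θ =>
    mul_div_assoc _ _ _
  have hG2 : ∀ r ∈ Icc (ρ - δ) (ρ + δ), ∀ θ, 1 / 2 ≤ 1 + ε * G r θ ∧ 1 + ε * G r θ ≤ 2 :=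
    fun r hr θ => by
      have := abs_le.1 (hest θ r hr).2.1
      exact ⟨by linarith [this.1], by linarith [this.2]⟩
  have hann : IsAnnularField (v ε) (fun r θ => ε * S r θ) (fun r θ => 1 + ε * G r θ) ρ δ :=
    ⟨hv ε, hδ, hδρ, fun r hr θ => hpol ε r (by linarith [hr.1]) θ,
      fun r hr θ => (hG2 r hr θ).1, fun r hr θ => (hG2 r hr θ).2⟩
  obtain ⟨φ, hφper, hφ, hφmem⟩ : ∃ φ : ℝ → ℝ, Function.Periodic φ (2 * π) ∧
      (∀ θ, HasDerivAt φ (ε * S (φ θ) θ / (1 + ε * G (φ θ) θ)) θ) ∧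
      ∀ θ, φ θ ∈ Icc (ρ - δ / 2) (ρ + δ / 2) := by
    -- Applied with half-width `δ / 2`, so the test radii are `ρ ± δ / 4`. There the main term of
    -- `c` times the displacement is `± ε δ c² / 4`, while three errors of size `κ * (δ / 2)`,
    -- integrated over a turn, contribute at most `3 ε δ c² / 16`.
    refine exists_periodic_solution (f := fun θ r => ε * S r θ / (1 + ε * G r θ)) (σ := c)
      (K := ε * (κ + D)) (L := ε * L) two_pi_pos (half_pos hδ) (fun r θ => ?_) (fun r hr => ?_)
      (fun θ r hr r' hr' => ?_) (fun θ r hr => ?_) (by linarith) (fun r hr hrm hrd => ?_)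
    · simp only [h.per_S r θ, h.per_G r θ]
    · have hr0 : 0 < r := by linarith [hr.1]
      refine ((h.continuous_S hr0).const_mul ε).div
        (continuous_const.add ((h.continuous_G hr0).const_mul ε)) fun θ => ?_
      linarith [(hG2 r (hsub r hr) θ).1]
    · have h2 := (hest θ r (hsub r hr)).2.2.2 r' (hsub r' hr')
      rw [hdiv, hdiv, ← mul_sub, abs_mul, abs_of_pos hε0, mul_assoc]
      refine mul_le_mul_of_nonneg_left ?_ hε0.le
      have h3 := abs_sub_abs_le_abs_sub
        (S r θ / (1 + ε * G r θ) - S r' θ / (1 + ε * G r' θ)) ((r - r') * S' ρ θ)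
      rw [abs_mul (r - r')] at h3
      have h4 := mul_le_mul_of_nonneg_left (hD θ) (abs_nonneg (r - r'))
      linarith
    · rw [hdiv, abs_mul, abs_of_pos hε0]
      exact mul_le_mul_of_nonneg_left (hest θ r (hsub r hr)).2.2.1 hε0.le
    · have hcint : Continuous fun θ => S ρ θ + (r 0 - ρ) * S' ρ θ :=
        hSc.add (hS'c.const_mul _)
      have hw : ∀ θ ∈ Icc 0 (2 * π), HasDerivWithinAt
          (fun θ => r θ - ε * ∫ τ in (0 : ℝ)..θ, (S ρ τ + (r 0 - ρ) * S' ρ τ))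
          (ε * S (r θ) θ / (1 + ε * G (r θ) θ) - ε * (S ρ θ + (r 0 - ρ) * S' ρ θ))
          (Icc 0 (2 * π)) θ := fun θ hθ =>
        (hr θ hθ).sub ((hcint.hasDerivAt_primitive 0 θ).const_mul ε).hasDerivWithinAt
      have hbd : ∀ θ ∈ Icc 0 (2 * π), ‖ε * S (r θ) θ / (1 + ε * G (r θ) θ) -
          ε * (S ρ θ + (r 0 - ρ) * S' ρ θ)‖ ≤ ε * (3 * (κ * (δ / 2))) := fun θ hθ => by
        rw [norm_eq_abs, hdiv, ← mul_sub, abs_mul, abs_of_pos hε0]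
        refine mul_le_mul_of_nonneg_left ?_ hε0.le
        have e1 := (hest θ (r θ) (hsub _ (hrm θ hθ))).2.2.2 ρ hρmem
        have e2 := (hav θ).le
        have e3 : |(r θ - r 0) * S' ρ θ| ≤ κ * (δ / 2) := by
          rw [abs_mul]
          refine (mul_le_mul (hrd θ hθ) (hD θ) (abs_nonneg _) (by positivity)).trans ?_
          linarith
        have e4 : κ * |r θ - ρ| ≤ κ * (δ / 2) := by
          refine mul_le_mul_of_nonneg_left (abs_le.2 ?_) hκpos.le
          have := hrm θ hθ
          exact ⟨by linarith [this.1], by linarith [this.2]⟩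
        calc _ = |(S (r θ) θ / (1 + ε * G (r θ) θ) - S ρ θ / (1 + ε * G ρ θ) -
              (r θ - ρ) * S' ρ θ) + (S ρ θ / (1 + ε * G ρ θ) - S ρ θ) +
              (r θ - r 0) * S' ρ θ| := by congr 1; ring
          _ ≤ _ := (abs_add_three _ _ _).trans (by linarith)
      have hfin := (convex_Icc 0 (2 * π)).norm_image_sub_le_of_norm_hasDerivWithin_le hw hbd
        (x := 0) (y := 2 * π) ⟨le_rfl, two_pi_pos.le⟩ ⟨two_pi_pos.le, le_rfl⟩
      have hint : ∫ τ in (0 : ℝ)..(2 * π), (S ρ τ + (r 0 - ρ) * S' ρ τ) = (r 0 - ρ) * c := by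
        rw [intervalIntegral.integral_add (hSc.intervalIntegrable _ _)
          ((hS'c.const_mul _).intervalIntegrable _ _), h0, zero_add,
          intervalIntegral.integral_const_mul]
      simp only [hint, intervalIntegral.integral_same, mul_zero, sub_zero, norm_eq_abs,
        abs_of_pos two_pi_pos] at hfin
      set X := r (2 * π) - ε * ((r 0 - ρ) * c) - r 0 with hX
      have hval : ε * (3 * (κ * (δ / 2))) * (2 * π) = ε * δ * |c| * (3 / 16) := by
        rw [← hκc]; ring
      rw [hval] at hfin
      have hXc : |c * X| ≤ ε * δ * c ^ 2 * (3 / 16) := by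
        rw [abs_mul, ← sq_abs c]
        refine (mul_le_mul_of_nonneg_left hfin (abs_nonneg c)).trans_eq ?_
        ring
      have hdisp : c * (r (2 * π) - r 0) = ε * (r 0 - ρ) * c ^ 2 + c * X := by rw [hX]; ring
      have hpos : 0 < ε * δ * c ^ 2 := by positivity
      have hab := abs_le.1 hXc
      refine ⟨fun hr0 => ?_, fun hr0 => ?_⟩
      · rw [hdisp, hr0]; linarith [hab.2]
      · rw [hdisp, hr0]; linarith [hab.1]
  refine ⟨φ, δ, hδs, hφper, hann, hφ, hφmem, fun θ => (hest θ _ (hsub _ (hφmem θ))).1, ?_⟩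
  -- The weight is the primitive of the oscillating part of `ε S'(ρ, ·)`, periodic because the mean
  -- is removed. What remains is the constant rate `ε c / (2π)`, which dominates the error `ε κ = ε
  -- |c| / (16π)`.
  have hgc : Continuous fun θ => ε * (S' ρ θ - c / (2 * π)) :=
    (hS'c.sub continuous_const).const_mul ε
  have hgper : Function.Periodic (fun θ => ε * (S' ρ θ - c / (2 * π))) (2 * π) := fun θ => by
    simp only [h.per_S' ρ θ]
  have hg0 : ∫ θ in (0 : ℝ)..(2 * π), ε * (S' ρ θ - c / (2 * π)) = 0 := by
    rw [intervalIntegral.integral_const_mul, intervalIntegral.integral_sub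
      (hS'c.intervalIntegrable _ _) intervalIntegrable_const, intervalIntegral.integral_const, ← hc,
      smul_eq_mul, sub_zero, mul_div_cancel₀ _ two_pi_pos.ne', sub_self, mul_zero]
  refine hann.isLimitCycle (σ := c) hφper (hgper.periodic_primitive hgc hg0) hφ
    (fun θ => hgc.hasDerivAt_primitive 0 θ) hφmem h1 fun r hr θ hne => ?_
  have e1 := (hest θ r hr).2.2.2 (φ θ) (hsub _ (hφmem θ))
  rw [hdiv, hdiv]
  set E := S r θ / (1 + ε * G r θ) - S (φ θ) θ / (1 + ε * G (φ θ) θ) - (r - φ θ) * S' ρ θ with hE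
  have hmain : c * ((r - φ θ) * (ε * (S r θ / (1 + ε * G r θ)) -
      ε * (S (φ θ) θ / (1 + ε * G (φ θ) θ)) - (r - φ θ) * (ε * (S' ρ θ - c / (2 * π))))) =
      ε * ((r - φ θ) ^ 2 * (c ^ 2 / (2 * π)) + c * (r - φ θ) * E) := by
    rw [hE]; ring
  rw [hmain]
  refine mul_pos hε0 ?_
  have hsq : 0 < (r - φ θ) ^ 2 := by
    have := sub_ne_zero.2 hne
    positivity
  have e2 : |c * (r - φ θ) * E| ≤ (r - φ θ) ^ 2 * (c ^ 2 / (16 * π)) := by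
    rw [abs_mul, abs_mul]
    calc |c| * |r - φ θ| * |E| ≤ |c| * |r - φ θ| * (κ * |r - φ θ|) :=
          mul_le_mul_of_nonneg_left e1 (by positivity)
      _ = |r - φ θ| ^ 2 * (|c| ^ 2 / (16 * π)) := by rw [hκ]; ring
      _ = _ := by rw [sq_abs, sq_abs]
  have e3 : c ^ 2 / (16 * π) < c ^ 2 / (2 * π) := by
    refine div_lt_div_of_pos_left (by positivity) (by positivity) (by linarith)
  have e4 := mul_lt_mul_of_pos_left e3 hsq
  linarith [(abs_le.1 e2).1]

end IsAveragingData

/-! ### Homogeneous perturbations of the linear centre. -/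

/-- The radial component of a field on the unit circle. -/
def radialPart (X : ℝ × ℝ → ℝ × ℝ) (θ : ℝ) : ℝ :=
  (X (cos θ, sin θ)).1 * cos θ + (X (cos θ, sin θ)).2 * sin θ

/-- The tangential component of a field on the unit circle. -/
def tangentialPart (X : ℝ × ℝ → ℝ × ℝ) (θ : ℝ) : ℝ :=
  (X (cos θ, sin θ)).2 * cos θ - (X (cos θ, sin θ)).1 * sin θ

theorem continuous_radialPart {X : ℝ × ℝ → ℝ × ℝ} (hX : Continuous X) :
    Continuous (radialPart X) := by
  have h : Continuous fun θ : ℝ => X (cos θ, sin θ) :=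
    hX.comp (continuous_cos.prodMk continuous_sin)
  exact (h.fst.mul continuous_cos).add (h.snd.mul continuous_sin)

theorem continuous_tangentialPart {X : ℝ × ℝ → ℝ × ℝ} (hX : Continuous X) :
    Continuous (tangentialPart X) := by
  have h : Continuous fun θ : ℝ => X (cos θ, sin θ) :=
    hX.comp (continuous_cos.prodMk continuous_sin)
  exact (h.snd.mul continuous_cos).sub (h.fst.mul continuous_sin)

theorem periodic_radialPart (X : ℝ × ℝ → ℝ × ℝ) : Function.Periodic (radialPart X) (2 * π) :=
  fun θ => by simp only [radialPart, cos_add_two_pi, sin_add_two_pi]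

theorem periodic_tangentialPart (X : ℝ × ℝ → ℝ × ℝ) :
    Function.Periodic (tangentialPart X) (2 * π) :=
  fun θ => by simp only [tangentialPart, cos_add_two_pi, sin_add_two_pi]

/-- The sum `∑ j, b j * r ^ e j * F j θ`. -/
def polarSum {N : ℕ} (b e : Fin N → ℝ) (F : Fin N → ℝ → ℝ) (r θ : ℝ) : ℝ :=
  ∑ j, b j * r ^ e j * F j θ

section polarSum

variable {N : ℕ} (b e : Fin N → ℝ) {F : Fin N → ℝ → ℝ}

theorem hasDerivAt_polarSum (F : Fin N → ℝ → ℝ) {r : ℝ} (hr : 0 < r) (θ : ℝ) :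
    HasDerivAt (fun r => polarSum b e F r θ)
      (polarSum (fun j => b j * e j) (fun j => e j - 1) F r θ) r := by
  unfold polarSum
  refine (HasDerivAt.fun_sum fun j _ => (((hasDerivAt_rpow_const (p := e j)
    (Or.inl hr.ne')).const_mul (b j)).mul_const (F j θ))).congr_deriv ?_
  exact Finset.sum_congr rfl fun j _ => by ring

theorem continuousAt_polarSum (hF : ∀ j, Continuous (F j)) {r : ℝ} (hr : 0 < r) (θ : ℝ) :
    ContinuousAt (fun z : ℝ × ℝ => polarSum b e F z.1 z.2) (r, θ) := by
  refine tendsto_finsetSum _ fun j _ => ?_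
  exact (continuousAt_const.mul (continuousAt_fst.rpow_const (Or.inl hr.ne'))).mul
    ((hF j).continuousAt.comp continuousAt_snd)

theorem periodic_polarSum (hF : ∀ j, Function.Periodic (F j) (2 * π)) (r : ℝ) :
    Function.Periodic (polarSum b e F r) (2 * π) := fun θ => by
  simp only [polarSum, (hF _) θ]

theorem integral_polarSum (hF : ∀ j, Continuous (F j)) (r : ℝ) :
    ∫ θ in (0 : ℝ)..(2 * π), polarSum b e F r θ =
      ∑ j, b j * r ^ e j * ∫ θ in (0 : ℝ)..(2 * π), F j θ := by
  unfold polarSum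
  rw [intervalIntegral.integral_finsetSum fun j _ => ((hF j).const_mul _).intervalIntegrable _ _]
  simp only [intervalIntegral.integral_const_mul]

end polarSum

section perturbedCenter

variable {n : ℕ} {X : Fin (n + 1) → ℝ × ℝ → ℝ × ℝ} {α : Fin (n + 1) → ℝ}

theorem continuous_perturbedCenter (hcont : ∀ j, Continuous (X j)) (a : Fin (n + 1) → ℝ) :
    Continuous (perturbedCenter X a) := by
  unfold perturbedCenter
  fun_prop

theorem perturbedCenter_polarPoint (hhom : ∀ j, IsHomogeneousField (X j) (α j))
    (b : Fin (n + 1) → ℝ) (ε : ℝ) {r : ℝ} (hr : 0 < r) (θ : ℝ) :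
    perturbedCenter X (fun j => ε * b j) (polarPoint r θ) =
      (ε * polarSum b α (fun j => radialPart (X j)) r θ * cos θ -
        r * (1 + ε * polarSum b (fun j => α j - 1) (fun j => tangentialPart (X j)) r θ) * sin θ,
      ε * polarSum b α (fun j => radialPart (X j)) r θ * sin θ +
        r * (1 + ε * polarSum b (fun j => α j - 1) (fun j => tangentialPart (X j)) r θ) * cos θ) := by
  have hX : ∀ j, X j (polarPoint r θ) = r ^ α j • X j (cos θ, sin θ) := fun j =>
    (hhom j).2 (cos θ, sin θ) r hr.le
  have hpow : ∀ j, r ^ α j = r ^ (α j - 1) * r := fun j => by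
    rw [← rpow_add_one hr.ne', sub_add_cancel]
  have hcs := cos_sq_add_sin_sq θ
  have key1 : ∑ j, ε * b j * (r ^ α j * (X j (cos θ, sin θ)).1) =
      ε * polarSum b α (fun j => radialPart (X j)) r θ * cos θ -
        r * (ε * polarSum b (fun j => α j - 1) (fun j => tangentialPart (X j)) r θ) * sin θ := by
    simp only [polarSum, Finset.mul_sum, Finset.sum_mul, ← Finset.sum_sub_distrib]
    refine Finset.sum_congr rfl fun j _ => ?_
    rw [radialPart, tangentialPart, hpow]
    linear_combination (-(ε * b j * (r ^ (α j - 1) * r) * (X j (cos θ, sin θ)).1)) * hcs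
  have key2 : ∑ j, ε * b j * (r ^ α j * (X j (cos θ, sin θ)).2) =
      ε * polarSum b α (fun j => radialPart (X j)) r θ * sin θ +
        r * (ε * polarSum b (fun j => α j - 1) (fun j => tangentialPart (X j)) r θ) * cos θ := by
    simp only [polarSum, Finset.mul_sum, Finset.sum_mul, ← Finset.sum_add_distrib]
    refine Finset.sum_congr rfl fun j _ => ?_
    rw [radialPart, tangentialPart, hpow]
    linear_combination (-(ε * b j * (r ^ (α j - 1) * r) * (X j (cos θ, sin θ)).2)) * hcs
  refine Prod.ext ?_ ?_ <;>
    simp only [perturbedCenter, Prod.fst_add, Prod.snd_add, Prod.fst_sum, Prod.snd_sum,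
      Prod.smul_fst, Prod.smul_snd, smul_eq_mul, hX]
  · rw [key1, polarPoint]
    ring
  · rw [key2, polarPoint]
    ring

/-- Continuity of the `X j` suffices: all differentiation is in `r`, where only powers occur. -/
theorem isAveragingData_polarSum (hcont : ∀ j, Continuous (X j)) (b : Fin (n + 1) → ℝ) :
    IsAveragingData (polarSum b α fun j => radialPart (X j))
      (polarSum (fun j => b j * α j) (fun j => α j - 1) fun j => radialPart (X j))
      (polarSum b (fun j => α j - 1) fun j => tangentialPart (X j))
      (polarSum (fun j => b j * (α j - 1)) (fun j => α j - 1 - 1) fun j => tangentialPart (X j)) where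
  deriv_S _ hr θ := hasDerivAt_polarSum _ _ _ hr θ
  deriv_G _ hr θ := hasDerivAt_polarSum _ _ _ hr θ
  cont_S _ hr θ := continuousAt_polarSum _ _ (fun j => continuous_radialPart (hcont j)) hr θ
  cont_S' _ hr θ := continuousAt_polarSum _ _ (fun j => continuous_radialPart (hcont j)) hr θ
  cont_G _ hr θ := continuousAt_polarSum _ _ (fun j => continuous_tangentialPart (hcont j)) hr θ
  cont_G' _ hr θ := continuousAt_polarSum _ _ (fun j => continuous_tangentialPart (hcont j)) hr θ
  per_S r := periodic_polarSum _ _ (fun j => periodic_radialPart (X j)) r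
  per_S' r := periodic_polarSum _ _ (fun j => periodic_radialPart (X j)) r
  per_G r := periodic_polarSum _ _ (fun j => periodic_tangentialPart (X j)) r
  per_G' r := periodic_polarSum _ _ (fun j => periodic_tangentialPart (X j)) r

theorem contDiff_perturbedCenter (hX : ∀ j, ContDiff ℝ 1 (X j)) (a : Fin (n + 1) → ℝ) :
    ContDiff ℝ 1 (perturbedCenter X a) := by
  unfold perturbedCenter
  fun_prop

theorem planarTrace_fderiv_perturbedCenter (hX : ∀ j, ContDiff ℝ 1 (X j)) (a : Fin (n + 1) → ℝ)
    (p : ℝ × ℝ) : planarTrace (fderiv ℝ (perturbedCenter X a) p) =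
      ∑ j, a j * planarTrace (fderiv ℝ (X j) p) := by
  let J : ℝ × ℝ →L[ℝ] ℝ × ℝ :=
    (-ContinuousLinearMap.snd ℝ ℝ ℝ).prod (ContinuousLinearMap.fst ℝ ℝ ℝ)
  have h : HasFDerivAt (perturbedCenter X a) (J + ∑ j, a j • fderiv ℝ (X j) p) p :=
    J.hasFDerivAt.add (HasFDerivAt.fun_sum fun j _ =>
      (((hX j).differentiable one_ne_zero) p).hasFDerivAt.const_smul (a j))
  rw [h.fderiv]
  simp [planarTrace, J, Prod.fst_sum, Prod.snd_sum, ← Finset.sum_add_distrib, mul_add]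

/-- A simple zero `ρ` of the averaged function `∑ j, b j * I j * r ^ α j` gives limit cycles near the
circle of radius `ρ`, which are hyperbolic in the `C¹` case. -/
theorem eventually_exists_limitCycle_perturbedCenter (hcont : ∀ j, Continuous (X j))
    (hhom : ∀ j, IsHomogeneousField (X j) (α j)) (b : Fin (n + 1) → ℝ) {ρ s : ℝ} (hρ : 0 < ρ)
    (h0 : ∑ j, b j * radialIntegral (X j) * ρ ^ α j = 0)
    (h1 : ∑ j, b j * radialIntegral (X j) * α j * ρ ^ α j ≠ 0) (hs : 0 < s) :
    ∀ᶠ ε in 𝓝[>] (0 : ℝ), ∃ Γ : Set (ℝ × ℝ), Γ.Nonempty ∧ (∀ p ∈ Γ, |radius p - ρ| < s) ∧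
      IsLimitCycle (perturbedCenter X fun j => ε * b j) Γ ∧
      ((∀ j, ContDiff ℝ 1 (X j)) → IsHyperbolicOrbit (perturbedCenter X fun j => ε * b j) Γ) := by
  have hFc : ∀ j, Continuous (radialPart (X j)) := fun j => continuous_radialPart (hcont j)
  have hI : ∀ j, ∫ θ in (0 : ℝ)..(2 * π), radialPart (X j) θ = radialIntegral (X j) := fun j => rfl
  have hpow : ∀ j, ρ ^ (α j - 1) = ρ ^ α j / ρ := fun j => rpow_sub_one hρ.ne' _
  have hS0 : ∫ θ in (0 : ℝ)..(2 * π), polarSum b α (fun j => radialPart (X j)) ρ θ = 0 := by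
    rw [integral_polarSum _ _ hFc]
    refine Eq.trans ?_ h0
    exact Finset.sum_congr rfl fun j _ => by rw [hI]; ring
  have hS1 : ∫ θ in (0 : ℝ)..(2 * π), polarSum (fun j => b j * α j) (fun j => α j - 1)
      (fun j => radialPart (X j)) ρ θ ≠ 0 := by
    rw [integral_polarSum _ _ hFc]
    have : ∑ j, b j * α j * ρ ^ (α j - 1) * ∫ θ in (0 : ℝ)..(2 * π), radialPart (X j) θ =
        (∑ j, b j * radialIntegral (X j) * α j * ρ ^ α j) / ρ := by
      rw [Finset.sum_div]
      exact Finset.sum_congr rfl fun j _ => by rw [hI, hpow]; ring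
    rw [this]
    exact div_ne_zero h1 hρ.ne'
  -- The tolerance is fixed before `ε`, so that the divergence integral is nonzero along any curve
  -- that close to the circle.
  obtain ⟨s', hs', hs's, hhyp⟩ : ∃ s' > 0, s' ≤ s ∧ ((∀ j, ContDiff ℝ 1 (X j)) →
      ∀ (φ Θ w : ℝ → ℝ) (T : ℝ), Continuous φ → (∀ θ, |φ θ - ρ| < s') → 0 < T → Θ 0 = 0 →
        Θ T = 2 * π → (∀ t, HasDerivAt Θ (w t) t) → Continuous w → (∀ t, |w t - 1| ≤ s') →
        ∫ t in (0 : ℝ)..T, ∑ j, b j *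
          planarTrace (fderiv ℝ (X j) (polarPoint (φ (Θ t)) (Θ t))) ≠ 0) := by
    by_cases hC : ∀ j, ContDiff ℝ 1 (X j)
    · have htr : ∀ j, Continuous fun p => planarTrace (fderiv ℝ (X j) p) := fun j => by
        have hA := (hC j).continuous_fderiv one_ne_zero
        exact (hA.clm_apply continuous_const).fst.add (hA.clm_apply continuous_const).snd
      have hc : Continuous fun p => ∑ j, b j * planarTrace (fderiv ℝ (X j) p) :=
        continuous_finsetSum _ fun j _ => (htr j).const_mul _
      obtain ⟨s₁, hs₁, hH⟩ := exists_integral_ne_zero_of_near_circle hc (ρ := ρ) (by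
        have hpc : Continuous fun θ => polarPoint ρ θ :=
          continuous_polarPoint continuous_const continuous_id
        have hint : ∀ j ∈ Finset.univ, IntervalIntegrable (fun θ =>
            b j * planarTrace (fderiv ℝ (X j) (polarPoint ρ θ))) MeasureTheory.volume 0 (2 * π) :=
          fun j _ => (((htr j).comp hpc).const_mul _).intervalIntegrable _ _
        rw [intervalIntegral.integral_finsetSum hint]
        simp only [intervalIntegral.integral_const_mul]
        -- The factor `α j + 1` splits the divergence integral into the derivative of the averaged
        -- polynomial and its value over `ρ`; the latter vanishes.
        have : ∑ j, b j * ∫ θ in (0 : ℝ)..(2 * π), planarTrace (fderiv ℝ (X j) (polarPoint ρ θ)) =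
            (∑ j, b j * radialIntegral (X j) * α j * ρ ^ α j) / ρ +
              (∑ j, b j * radialIntegral (X j) * ρ ^ α j) / ρ := by
          rw [Finset.sum_div, Finset.sum_div, ← Finset.sum_add_distrib]
          refine Finset.sum_congr rfl fun j _ => ?_
          rw [integral_divergence_circle (hC j) (hhom j) hρ, hpow]
          ring
        rw [this, h0, zero_div, add_zero]
        exact div_ne_zero h1 hρ.ne')
      exact ⟨min s s₁, lt_min hs hs₁, min_le_left _ _, fun _ φ Θ w T hφ hφρ hT hΘ0 hΘT hΘ hw hw1 =>
        hH φ Θ w T hφ (fun θ => (hφρ θ).trans_le (min_le_right _ _)) hT hΘ0 hΘT hΘ hw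
          fun t => (hw1 t).trans (min_le_right _ _)⟩
    · exact ⟨s, hs, le_rfl, fun h => absurd h hC⟩
  filter_upwards [(isAveragingData_polarSum hcont b).eventually_exists_limitCycle (s := s') hρ hS0 hS1
    (fun ε => continuous_perturbedCenter hcont fun j => ε * b j)
    (fun ε r hr θ => perturbedCenter_polarPoint hhom b ε hr θ) hs', self_mem_nhdsWithin]
    with ε hε hεpos
  obtain ⟨φ, δ, hδs, hφper, hann, hφ, hφmem, hφG, hlim⟩ := hε
  have hδ := hann.pos
  have hφρ : ∀ θ, |φ θ - ρ| < s' := fun θ => by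
    rw [abs_lt]
    constructor <;> linarith [(hφmem θ).1, (hφmem θ).2]
  have hφmem' : ∀ θ, φ θ ∈ Icc (ρ - δ) (ρ + δ) := fun θ =>
    ⟨by linarith [(hφmem θ).1], by linarith [(hφmem θ).2]⟩
  refine ⟨_, range_nonempty _, ?_, hlim, fun hC => ?_⟩
  · rintro _ ⟨θ, rfl⟩
    rw [radius_polarPoint (hann.radius_pos (hφmem' θ)).le]
    exact (hφρ θ).trans_le hs's
  · obtain ⟨Θ, T, hsol, hΘ0, hΘT, hΘ, hwc, hsurj⟩ :=
      hann.exists_isPeriodicSolution hφper hφ hφmem'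
    have hφc : Continuous φ := continuous_iff_continuousAt.2 fun θ => (hφ θ).continuousAt
    have hΓ : range (fun t => polarPoint (φ (Θ t)) (Θ t)) = range fun θ => polarPoint (φ θ) θ :=
      hsurj.range_comp fun θ => polarPoint (φ θ) θ
    rw [← hΓ]
    refine isHyperbolicOrbit_of_integral_ne_zero (contDiff_perturbedCenter hC _) hsol
      (fun t hz => ?_) ?_
    · have e1 := hann.angular_eq (hφmem' (Θ t)) (Θ t)
      have e2 := hann.half_le _ (hφmem' (Θ t)) (Θ t)
      rw [hz] at e1
      simp only [Prod.fst_zero, Prod.snd_zero, zero_mul, sub_self, zero_div] at e1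
      simp only [e1] at e2
      norm_num at e2
    · have hne := hhyp hC φ Θ _ T hφc hφρ hsol.pos hΘ0 hΘT hΘ hwc fun t => by
        rw [add_sub_cancel_left]; exact hφG (Θ t)
      simp only [planarTrace_fderiv_perturbedCenter hC, mul_assoc, ← Finset.mul_sum]
      rw [intervalIntegral.integral_const_mul]
      exact mul_ne_zero (ne_of_gt hεpos) hne

end perturbedCenter

end

/-! ### All zeros at once. -/

theorem theorem1p1 (n m : ℕ) (X : Fin (n + 1) → ℝ × ℝ → ℝ × ℝ) (α : Fin (n + 1) → ℝ)
    (hcont : ∀ j, Continuous (X j))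
    (hhom : ∀ j, IsHomogeneousField (X j) (α j))
    (hα : StrictMono α)
    (hm : {j : Fin (n + 1) | radialIntegral (X j) ≠ 0}.ncard = m + 1) :
    ∃ (a : Fin (n + 1) → ℝ) (Γ : Fin m → Set (ℝ × ℝ)),
      Function.Injective Γ ∧
      (∀ i, IsLimitCycle (perturbedCenter X a) (Γ i)) ∧
      ((∀ j, ContDiff ℝ 1 (X j)) → ∀ i, IsHyperbolicOrbit (perturbedCenter X a) (Γ i)) := by
  obtain ⟨b, ρ, hρ, hb⟩ := exists_generalizedPolynomial_simple_zeros _ α hα hm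
  -- Such an `s` makes the annuli around the circles of radii `ρ i` disjoint, so the cycles are
  -- distinct. Finiteness of the index set then provides one `ε` for all of them.
  have hsep : ∀ᶠ s in 𝓝[>] (0 : ℝ), ∀ i j, i ≠ j → s + s < |ρ i - ρ j| := by
    refine Filter.eventually_all.2 fun i => Filter.eventually_all.2 fun j => ?_
    by_cases hij : i = j
    · exact Filter.Eventually.of_forall fun s h => absurd hij h
    · have hpos : 0 < |ρ i - ρ j| := abs_pos.2 (sub_ne_zero.2 fun h => hij (hρ.injective h))
      have hc : ContinuousAt (fun s : ℝ => s + s) 0 := by fun_prop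
      have := hc.eventually (gt_mem_nhds (show (0 : ℝ) + 0 < |ρ i - ρ j| by simpa using hpos))
      exact (this.filter_mono nhdsWithin_le_nhds).mono fun s hs _ => hs
  obtain ⟨s, hs, hs0⟩ := (hsep.and self_mem_nhdsWithin).exists
  have hev : ∀ᶠ ε in 𝓝[>] (0 : ℝ), ∀ i, _ := Filter.eventually_all.2 fun i =>
    eventually_exists_limitCycle_perturbedCenter hcont hhom b (s := s) (hb i).1 (hb i).2.1
      (hb i).2.2 hs0
  obtain ⟨ε, hε⟩ := hev.exists
  choose Γ hne hnear hlim hhyp using hε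
  refine ⟨fun j => ε * b j, Γ, fun i j hij => ?_, hlim, fun hC i => hhyp i hC⟩
  by_contra hcon
  obtain ⟨p, hp⟩ := hne i
  have h1 := hnear i p hp
  have h2 := hnear j p (hij ▸ hp)
  have h3 := abs_sub_le (ρ i) (radius p) (ρ j)
  rw [abs_sub_comm (ρ i) (radius p)] at h3
  linarith [hs i j hcon]
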